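/- Let $G$ be a connected reductive algebraic group over $\mathbb{C}$ (reductive meaning that every finite-dimensional rational representation is completely reducible), let $X$ be a smooth affine variety over $\mathbb{C}$ with a regular action of $G$, and let $\mathscr{D}(X)$ be the ring of algebraic differential operators on $X$. Let $\nu \colon \mathfrak{g} \to \mathscr{D}(X)$ be the infinitesimal action (the differential of the action $(g \cdot f)(x) = f(g^{-1}x)$ on functions). Let $\mathrm{QCoh}(\mathscr{D}_X,G)$ be the category of $G$-equivariant quasi-coherent $\mathscr{D}_X$-modules on $X$. Since $X$ is affine, we identify it with the category of left $\mathscr{D}(X)$-modules $M$ that are also rational $G$-modules, such that the multiplication map $\mathscr{D}(X) \otimes M \to M$ is $G$-equivariant and the differential of the $G$-action on $M$ agrees with the action of $\nu(\mathfrak{g})$; morphisms are the $\mathscr{D}(X)$-linear $G$-equivariant maps. It is an abelian category. Let $P^+$ be the set of dominant weights of $G$, identified with the set of isomorphism classes of irreducible finite-dimensional rational representations of $G$. For $\lambda \in P^+$ and $\mathscr{M} \in \mathrm{QCoh}(\mathscr{D}_X,G)$ let $\Gamma(X,\mathscr{M})_\lambda$ be the $\lambda$-isotypic component of $\Gamma(X,\mathscr{M})$.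 Let $U \subset P^+$ be any subset, and let $\mathrm{QCoh}(\mathscr{D}_X,G)_U$ be the full subcategory of $\mathrm{QCoh}(\mathscr{D}_X,G)$ of all $\mathscr{M}$ with $\Gamma(X,\mathscr{M})_\lambda = 0$ for all $\lambda \in U$. Then $\mathrm{QCoh}(\mathscr{D}_X,G)_U$ is a Serre subcategory, so that the quotient category $\mathrm{QCoh}(\mathscr{D}_X,G)(U) := \mathrm{QCoh}(\mathscr{D}_X,G)/\mathrm{QCoh}(\mathscr{D}_X,G)_U$ is defined. The quotient functor $j^* \colon \mathrm{QCoh}(\mathscr{D}_X,G) \to \mathrm{QCoh}(\mathscr{D}_X,G)(U)$ admits a left adjoint $j_*$ and a right adjoint $j_!$, and the inclusion $i_* \colon \mathrm{QCoh}(\mathscr{D}_X,G)_U \to \mathrm{QCoh}(\mathscr{D}_X,G)$ admits a left adjoint $i^*$ and a right adjoint $i^!$. These six functors form a recollement of abelian categories: $i_*$ and $j^*$ are additive, $i_*$, $j_*$ and $j_!$ are fully faithful, and the essential image of $i_*$ consists of exactly those $\mathscr{M}$ with $j^*\mathscr{M} = 0$. -/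

import Mathlib

open CategoryTheory CategoryTheory.Limits
open scoped TensorProduct

universe u

/-! ### Differential operators on an affine variety -/

namespace EqDMod

section DiffOp

variable (A : Type u) [CommRing A] [Algebra ℂ A]

/-- Multiplication by a function, as a `ℂ`-linear endomorphism of the coordinate ring. -/
abbrev mulOp (a : A) : Module.End ℂ A := LinearMap.mulLeft ℂ a

/-- Grothendieck's filtration: `IsDiffOp A n P` says that `P` is a differential operator of
order `< n`, that is `P = 0` if `n = 0`, and all commutators `[P, a]` have order `< n - 1`
otherwise. -/
def IsDiffOp : ℕ → Module.End ℂ A → Prop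
  | 0, P => P = 0
  | n + 1, P => ∀ a : A, IsDiffOp n (P * mulOp A a - mulOp A a * P)

variable {A}

lemma IsDiffOp.zero (n : ℕ) : IsDiffOp A n 0 := by
  induction n with
  | zero => rfl
  | succ n ih => intro a; simpa using ih

lemma IsDiffOp.add {n : ℕ} {P Q : Module.End ℂ A} (hP : IsDiffOp A n P) (hQ : IsDiffOp A n Q) :
    IsDiffOp A n (P + Q) := by
  induction n generalizing P Q with
  | zero => simp only [IsDiffOp] at *; simp [hP, hQ]
  | succ n ih =>
    intro a
    have := ih (hP a) (hQ a)
    convert this using 1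
    noncomm_ring

lemma IsDiffOp.succ {n : ℕ} {P : Module.End ℂ A} (hP : IsDiffOp A n P) :
    IsDiffOp A (n + 1) P := by
  induction n generalizing P with
  | zero =>
    simp only [IsDiffOp] at hP
    subst hP
    exact IsDiffOp.zero 1
  | succ n ih => intro a; exact ih (hP a)

lemma IsDiffOp.mono {m n : ℕ} (h : m ≤ n) {P : Module.End ℂ A} (hP : IsDiffOp A m P) :
    IsDiffOp A n P := by
  induction h with
  | refl => exact hP
  | step _ ih => exact ih.succ

lemma IsDiffOp.mul {m n : ℕ} {P Q : Module.End ℂ A} (hP : IsDiffOp A m P)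
    (hQ : IsDiffOp A n Q) : IsDiffOp A (m + n) (P * Q) := by
  obtain ⟨k, hk⟩ : ∃ k, k = m + n := ⟨_, rfl⟩
  induction k generalizing m n P Q with
  | zero =>
    obtain ⟨rfl, rfl⟩ : m = 0 ∧ n = 0 := by omega
    simp only [IsDiffOp] at *
    simp [hP]
  | succ k ih =>
    rcases m with _ | m
    · simp only [IsDiffOp] at hP
      subst hP
      simpa using IsDiffOp.zero _
    rcases n with _ | n
    · simp only [IsDiffOp] at hQ
      subst hQ
      simpa using IsDiffOp.zero _
    have e : m + 1 + (n + 1) = (m + 1 + n) + 1 := by omega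
    rw [e]
    intro a
    have h1 := ih (m := m + 1) (n := n) hP (hQ a) (by omega)
    have h2 := ih (m := m) (n := n + 1) (hP a) hQ (by omega)
    have h2' : IsDiffOp A (m + 1 + n) _ := h2.mono (by omega)
    convert h1.add h2' using 1
    simp only [mul_sub, sub_mul, mul_assoc]
    abel

lemma IsDiffOp.algebraMap (c : ℂ) : IsDiffOp A 1 (algebraMap ℂ (Module.End ℂ A) c) := by
  intro a
  change _ = _
  rw [Algebra.commutes, sub_self]

lemma IsDiffOp.of_derivation {P : Module.End ℂ A}
    (hP : ∀ a b : A, P (a * b) = a * P b + P a * b) : IsDiffOp A 2 P := by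
  intro a b
  change _ = _
  ext c
  simp [hP]
  ring

variable (A)

/-- The ring `𝒟(X)` of algebraic differential operators on `X = Spec A`. -/
def DiffOp : Subalgebra ℂ (Module.End ℂ A) where
  carrier := {P | ∃ n, IsDiffOp A n P}
  mul_mem' := fun ⟨m, hm⟩ ⟨n, hn⟩ => ⟨m + n, hm.mul hn⟩
  add_mem' := fun ⟨m, hm⟩ ⟨n, hn⟩ =>
    ⟨max m n, (hm.mono (le_max_left _ _)).add (hn.mono (le_max_right _ _))⟩
  algebraMap_mem' := fun c => ⟨1, IsDiffOp.algebraMap c⟩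

instance : Ring (DiffOp A) := Subalgebra.toRing (DiffOp A)

variable {A}

lemma IsDiffOp.conj (l l' : A →ₐ[ℂ] A) (h : ∀ a, l (l' a) = a) {n : ℕ} {P : Module.End ℂ A}
    (hP : IsDiffOp A n P) : IsDiffOp A n (l.toLinearMap ∘ₗ P ∘ₗ l'.toLinearMap) := by
  induction n generalizing P with
  | zero =>
    simp only [IsDiffOp] at *
    simp [hP]
  | succ n ih =>
    intro a
    convert ih (hP (l' a)) using 1
    ext b
    simp [h]

end DiffOp

/-! ### Affine algebraic groups and their rational representations -/

section Group

variable (H : Type u) [CommRing H] [HopfAlgebra ℂ H]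

/-- The group `G(ℂ)` of the affine algebraic group `G = Spec H`, with its convolution product
`(g * h)(f) = ∑ g(f₁) h(f₂)`. -/
abbrev Pt := WithConv (H →ₐ[ℂ] ℂ)

/-- The Lie algebra of `G = Spec H`, as a space of linear forms: the derivations `x : H → ℂ`
at the identity. -/
def IsTangent (x : H →ₗ[ℂ] ℂ) : Prop :=
  ∀ a b : H, x (a * b) = Coalgebra.counit (R := ℂ) a * x b + x a * Coalgebra.counit (R := ℂ) b

variable {H}

/-- Contraction of the first factor with a linear form: `∑ hᵢ ⊗ vᵢ ↦ ∑ φ(hᵢ) vᵢ`. -/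
noncomputable def contract (φ : H →ₗ[ℂ] ℂ) (V : Type*) [AddCommGroup V] [Module ℂ V] :
    H ⊗[ℂ] V →ₗ[ℂ] V :=
  (TensorProduct.lid ℂ V).toLinearMap ∘ₗ φ.rTensor V

@[simp]
lemma contract_tmul (φ : H →ₗ[ℂ] ℂ) {V : Type*} [AddCommGroup V] [Module ℂ V] (h : H) (v : V) :
    contract φ V (h ⊗ₜ v) = φ h • v := by
  simp [contract]

lemma contract_lTensor (φ : H →ₗ[ℂ] ℂ) {V W : Type*} [AddCommGroup V] [Module ℂ V]
    [AddCommGroup W] [Module ℂ W] (f : V →ₗ[ℂ] W) (t : H ⊗[ℂ] V) :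
    contract φ W (f.lTensor H t) = f (contract φ V t) := by
  induction t with
  | zero => simp
  | tmul h v => simp
  | add s t hs ht => simp [hs, ht]

/-- Evaluation `∑ hᵢ ⊗ vᵢ ↦ ∑ hᵢ(g) vᵢ` of a regular function `G → V` at a point of `G`. -/
noncomputable abbrev evalAt (g : Pt H) (V : Type*) [AddCommGroup V] [Module ℂ V] :
    H ⊗[ℂ] V →ₗ[ℂ] V :=
  contract g.ofConv.toLinearMap V

/-- A representation of `G(ℂ)` is rational if every orbit map `g ↦ g • v` is a regular function
on `G` with values in a finite-dimensional subspace, i.e. an element of `H ⊗ V`. -/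
def IsRational {V : Type*} [AddCommGroup V] [Module ℂ V] (ρ : Representation ℂ (Pt H) V) : Prop :=
  ∀ v : V, ∃ t : H ⊗[ℂ] V, ∀ g : Pt H, ρ g v = evalAt g V t

variable (H)

/-- `G = Spec H` is reductive (over `ℂ`): every finite-dimensional rational representation is
completely reducible. -/
def IsReductive : Prop :=
  ∀ (V : Type u) [AddCommGroup V] [Module ℂ V] [FiniteDimensional ℂ V]
    (ρ : Representation ℂ (Pt H) V), IsRational ρ → ρ.IsSemisimpleRepresentation

/-- Irreducible finite-dimensional rational representations of `G = Spec H`. -/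
structure Irrep where
  V : Type u
  [addCommGroup : AddCommGroup V]
  [module : Module ℂ V]
  [finite : FiniteDimensional ℂ V]
  ρ : Representation ℂ (Pt H) V
  rational : IsRational ρ
  irreducible : ρ.IsIrreducible

attribute [instance] Irrep.addCommGroup Irrep.module Irrep.finite

/-- Isomorphism of irreducible representations. -/
instance irrepSetoid : Setoid (Irrep H) where
  r V W := Nonempty (V.ρ.Equiv W.ρ)
  iseqv :=
    ⟨fun V => ⟨Representation.Equiv.refl V.ρ⟩, fun ⟨e⟩ => ⟨e.symm⟩, fun ⟨e⟩ ⟨f⟩ => ⟨e.trans f⟩⟩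

/-- The set `P⁺` of dominant weights, identified with the set of isomorphism classes of
irreducible finite-dimensional rational representations. -/
def DominantWeight := Quotient (irrepSetoid H)

end Group

/-! ### Actions on affine varieties -/

section Action

variable (H A : Type u) [CommRing H] [HopfAlgebra ℂ H] [CommRing A] [Algebra ℂ A]

/-- A (left) action of `G = Spec H` on `X = Spec A`, given by the comorphism
`A = 𝒪(X) → 𝒪(G × X) = H ⊗ A` of the action map `G × X → X`. -/
structure AffineAction where
  coact : A →ₐ[ℂ] H ⊗[ℂ] A
  /-- `1 · x = x` -/
  counit_coact : ∀ a : A, contract (Coalgebra.counit (R := ℂ)) A (coact a) = a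
  /-- `(g h) · x = g · (h · x)` -/
  coassoc : ∀ a : A,
    TensorProduct.assoc ℂ H H A ((Coalgebra.comul (R := ℂ)).rTensor A (coact a)) =
      coact.toLinearMap.lTensor H (coact a)

variable {H A}

namespace AffineAction

variable (σ : AffineAction H A)

/-- Pullback of functions along the automorphism `x ↦ g · x` of `X`. -/
noncomputable def pull (g : Pt H) : A →ₐ[ℂ] A :=
  ((Algebra.TensorProduct.lid ℂ A).toAlgHom.comp
    (Algebra.TensorProduct.map g.ofConv (AlgHom.id ℂ A))).comp σ.coact

lemma pull_apply (g : Pt H) (a : A) : σ.pull g a = evalAt g A (σ.coact a) := by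
  change (Algebra.TensorProduct.lid ℂ A)
    (Algebra.TensorProduct.map g.ofConv (AlgHom.id ℂ A) (σ.coact a)) = _
  induction σ.coact a with
  | zero => simp
  | tmul h v => simp
  | add s t hs ht => simp only [map_add, hs, ht]

lemma pull_one (a : A) : σ.pull 1 a = a := by
  rw [pull_apply]
  conv_rhs => rw [← σ.counit_coact a]
  rfl

lemma pull_mul (g h : Pt H) (a : A) : σ.pull (g * h) a = σ.pull h (σ.pull g a) := by
  have h1 : ∀ t : H ⊗[ℂ] A, evalAt (g * h) A t =
      evalAt h A (evalAt g (H ⊗[ℂ] A)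
        (TensorProduct.assoc ℂ H H A ((Coalgebra.comul (R := ℂ)).rTensor A t))) := by
    intro t
    induction t with
    | zero => simp
    | add s t hs ht => simp only [map_add, hs, ht]
    | tmul x b =>
      have h2 : ∀ y : H ⊗[ℂ] H, evalAt h A (evalAt g (H ⊗[ℂ] A)
          (TensorProduct.assoc ℂ H H A (y ⊗ₜ b))) =
          (Algebra.TensorProduct.lmul' ℂ)
            (Algebra.TensorProduct.map g.ofConv h.ofConv y) • b := by
        intro y
        induction y with
        | zero => simp
        | add s t hs ht => simp only [map_add, TensorProduct.add_tmul, hs, ht, add_smul]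
        | tmul y z => simp [mul_smul]
      rw [LinearMap.rTensor_tmul, h2, contract_tmul]
      rfl
  rw [pull_apply, pull_apply, pull_apply, h1, σ.coassoc, contract_lTensor]
  rfl

/-- The action of `G(ℂ)` on functions, `(g • f)(x) = f(g⁻¹ · x)`. -/
noncomputable def translate (g : Pt H) : A →ₐ[ℂ] A := σ.pull g⁻¹

lemma translate_translate_inv (g : Pt H) (a : A) : σ.translate g (σ.translate g⁻¹ a) = a := by
  rw [translate, translate, ← pull_mul, inv_inv, mul_inv_cancel, pull_one]

/-- The action of `G(ℂ)` on differential operators: `(g • P)(f) = g • P(g⁻¹ • f)`. -/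
noncomputable def conj (g : Pt H) (P : DiffOp A) : DiffOp A :=
  ⟨(σ.translate g).toLinearMap ∘ₗ P.1 ∘ₗ (σ.translate g⁻¹).toLinearMap,
    let ⟨n, hn⟩ := P.2
    ⟨n, hn.conj _ _ (σ.translate_translate_inv g)⟩⟩

lemma contract_mul {x : H →ₗ[ℂ] ℂ} (hx : IsTangent H x) (s t : H ⊗[ℂ] A) :
    contract x A (s * t) =
      contract (Coalgebra.counit (R := ℂ)) A s * contract x A t +
        contract x A s * contract (Coalgebra.counit (R := ℂ)) A t := by
  induction s with
  | zero => simp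
  | add s s' hs hs' => simp only [add_mul, map_add, hs, hs']; ring
  | tmul h a =>
    induction t with
    | zero => simp
    | add t t' ht ht' => simp only [mul_add, map_add, ht, ht']; ring
    | tmul k b =>
      simp only [Algebra.TensorProduct.tmul_mul_tmul, contract_tmul, hx h k, add_smul,
        smul_mul_smul_comm]

/-- The infinitesimal action (comoment map) `ν : 𝔤 → 𝒟(X)`: the vector field `ν(x)` is the
derivative at `g = 1` in the direction `x` of `(g • f)(y) = f(g⁻¹ · y)`, whence the sign. -/
noncomputable def comoment (x : H →ₗ[ℂ] ℂ) (hx : IsTangent H x) : DiffOp A :=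
  ⟨-(contract x A ∘ₗ σ.coact.toLinearMap), 2, IsDiffOp.of_derivation fun a b => by
    simp only [LinearMap.neg_apply, LinearMap.comp_apply, AlgHom.toLinearMap_apply, map_mul,
      contract_mul hx, σ.counit_coact]
    ring⟩

end AffineAction

end Action

/-! ### Equivariant `𝒟`-modules -/

section QCoh

variable {H A : Type u} [CommRing H] [HopfAlgebra ℂ H] [CommRing A] [Algebra ℂ A]

/-- A `G`-equivariant `𝒟`-module on the affine `G`-variety `X = Spec A`, described by its global
sections: a left `𝒟(X)`-module with a rational `G`-action such that `𝒟(X) ⊗ M → M` is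
`G`-equivariant and the differential of the `G`-action agrees with the action of `ν(𝔤)`. -/
structure QCoh (σ : AffineAction H A) where
  carrier : Type u
  [addCommGroup : AddCommGroup carrier]
  [moduleC : Module ℂ carrier]
  [moduleD : Module (DiffOp A) carrier]
  [tower : IsScalarTower ℂ (DiffOp A) carrier]
  ρ : Representation ℂ (Pt H) carrier
  equivariant : ∀ (g : Pt H) (P : DiffOp A) (m : carrier), ρ g (P • m) = σ.conj g P • ρ g m
  /-- The orbit map `g ↦ g • m` is a regular function `t ∈ H ⊗ M`, whose derivative at `g = 1` in
  the direction `x ∈ 𝔤` is `ν(x) m`. -/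
  rational_differential : ∀ m : carrier, ∃ t : H ⊗[ℂ] carrier,
    (∀ g : Pt H, ρ g m = evalAt g carrier t) ∧
      ∀ (x : H →ₗ[ℂ] ℂ) (hx : IsTangent H x), contract x carrier t = σ.comoment x hx • m

attribute [instance] QCoh.addCommGroup QCoh.moduleC QCoh.moduleD QCoh.tower

namespace QCoh

variable {σ : AffineAction H A}

/-- Morphisms: `𝒟(X)`-linear `G`-equivariant maps. -/
@[ext]
structure Hom (M N : QCoh σ) where
  lin : M.carrier →ₗ[DiffOp A] N.carrier
  comm : ∀ (g : Pt H) (m : M.carrier), lin (M.ρ g m) = N.ρ g (lin m)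

instance : Category (QCoh σ) where
  Hom := Hom
  id M := ⟨LinearMap.id, fun _ _ => rfl⟩
  comp f g := ⟨g.lin ∘ₗ f.lin, fun x m => by simp [f.comm, g.comm]⟩

@[ext]
lemma hom_ext {M N : QCoh σ} {f g : M ⟶ N} (h : ∀ m, f.lin m = g.lin m) : f = g :=
  Hom.ext (LinearMap.ext h)

@[simp]
lemma id_lin (M : QCoh σ) (m : M.carrier) : Hom.lin (𝟙 M) m = m := rfl

@[simp]
lemma comp_lin {M N K : QCoh σ} (f : M ⟶ N) (g : N ⟶ K) (m : M.carrier) :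
    (f ≫ g).lin m = g.lin (f.lin m) := rfl

variable {M N : QCoh σ}

instance : Zero (M ⟶ N) := ⟨⟨0, fun _ _ => by simp⟩⟩
instance : Add (M ⟶ N) := ⟨fun f g => ⟨f.lin + g.lin, fun _ _ => by simp [f.comm, g.comm]⟩⟩
instance : Neg (M ⟶ N) := ⟨fun f => ⟨-f.lin, fun _ _ => by simp [f.comm]⟩⟩

@[simp] lemma zero_lin (m : M.carrier) : Hom.lin (0 : M ⟶ N) m = 0 := rfl
@[simp] lemma add_lin (f g : M ⟶ N) (m : M.carrier) : (f + g).lin m = f.lin m + g.lin m := rfl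
@[simp] lemma neg_lin (f : M ⟶ N) (m : M.carrier) : (-f).lin m = -f.lin m := rfl

instance : AddCommGroup (M ⟶ N) where
  add_assoc _ _ _ := by ext; simp [add_assoc]
  zero_add _ := by ext; simp
  add_zero _ := by ext; simp
  nsmul := nsmulRec
  zsmul := zsmulRec
  neg_add_cancel _ := by ext; simp
  add_comm _ _ := by ext; simp [add_comm]

instance : Preadditive (QCoh σ) where
  add_comp _ _ _ _ _ _ := by ext; simp
  comp_add _ _ _ _ _ _ := by ext; simp

/-- An equivariant submodule. -/
noncomputable def sub (M : QCoh σ) (S : Submodule (DiffOp A) M.carrier)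
    (hS : ∀ g, ∀ m ∈ S, M.ρ g m ∈ S) : QCoh σ where
  carrier := S
  ρ :=
    { toFun := fun g => (M.ρ g).restrict (p := S.restrictScalars ℂ) (q := S.restrictScalars ℂ)
        (hS g)
      map_one' := LinearMap.ext fun m => Subtype.ext (congrArg (· m.1) (map_one M.ρ))
      map_mul' := fun g h => LinearMap.ext fun m => Subtype.ext (congrArg (· m.1) (map_mul M.ρ g h)) }
  equivariant g P m := Subtype.ext (M.equivariant g P m)
  rational_differential m := by
    obtain ⟨t, ht, hx⟩ := M.rational_differential m.1
    obtain ⟨p, hp⟩ := (S.restrictScalars ℂ).exists_isCompl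
    let π := Submodule.projectionOnto _ _ hp
    have hπ : ∀ s : S, π s.1 = s := fun s => Submodule.projectionOnto_apply_left hp s
    refine ⟨π.lTensor H t, fun g => ?_, fun x h => ?_⟩
    · refine Eq.trans ?_ (contract_lTensor _ π t).symm
      rw [← ht g]
      exact (hπ ⟨M.ρ g m.1, hS g _ m.2⟩).symm
    · refine Eq.trans (contract_lTensor _ π t) ?_
      rw [hx x h]
      exact hπ (σ.comoment x h • m)

/-- The inclusion of an equivariant submodule. -/
noncomputable def subι (M : QCoh σ) (S : Submodule (DiffOp A) M.carrier)
    (hS : ∀ g, ∀ m ∈ S, M.ρ g m ∈ S) : M.sub S hS ⟶ M :=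
  ⟨S.subtype, fun _ _ => rfl⟩

/-- The quotient by an equivariant submodule. -/
noncomputable def quot (M : QCoh σ) (S : Submodule (DiffOp A) M.carrier)
    (hS : ∀ g, ∀ m ∈ S, M.ρ g m ∈ S) : QCoh σ where
  carrier := M.carrier ⧸ S
  ρ :=
    { toFun := fun g => (S.restrictScalars ℂ).mapQ (S.restrictScalars ℂ) (M.ρ g) (hS g)
      map_one' := LinearMap.ext fun m => by
        obtain ⟨m, rfl⟩ := S.mkQ_surjective m
        exact congrArg S.mkQ (congrArg (· m) (map_one M.ρ))
      map_mul' := fun g h => LinearMap.ext fun m => by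
        obtain ⟨m, rfl⟩ := S.mkQ_surjective m
        exact congrArg S.mkQ (congrArg (· m) (map_mul M.ρ g h)) }
  equivariant g P m := by
    obtain ⟨m, rfl⟩ := S.mkQ_surjective m
    exact congrArg S.mkQ (M.equivariant g P m)
  rational_differential m := by
    obtain ⟨m, rfl⟩ := S.mkQ_surjective m
    obtain ⟨t, ht, hx⟩ := M.rational_differential m
    let π : M.carrier →ₗ[ℂ] M.carrier ⧸ S := S.mkQ.restrictScalars ℂ
    refine ⟨π.lTensor H t, fun g => ?_, fun x h => ?_⟩
    · refine Eq.trans ?_ (contract_lTensor _ π t).symm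
      rw [← ht g]
      rfl
    · refine Eq.trans (contract_lTensor _ π t) ?_
      rw [hx x h]
      rfl

/-- The projection to a quotient. -/
noncomputable def quotπ (M : QCoh σ) (S : Submodule (DiffOp A) M.carrier)
    (hS : ∀ g, ∀ m ∈ S, M.ρ g m ∈ S) : M ⟶ M.quot S hS :=
  ⟨S.mkQ, fun _ _ => rfl⟩

/-- The direct sum of two equivariant modules. -/
noncomputable def prod (M N : QCoh σ) : QCoh σ where
  carrier := M.carrier × N.carrier
  ρ :=
    { toFun := fun g => (M.ρ g).prodMap (N.ρ g)
      map_one' := by ext <;> simp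
      map_mul' := fun _ _ => by ext <;> simp }
  equivariant g P m := Prod.ext (M.equivariant g P m.1) (N.equivariant g P m.2)
  rational_differential m := by
    obtain ⟨s, hs, hs'⟩ := M.rational_differential m.1
    obtain ⟨t, ht, ht'⟩ := N.rational_differential m.2
    refine ⟨(LinearMap.inl ℂ M.carrier N.carrier).lTensor H s +
      (LinearMap.inr ℂ M.carrier N.carrier).lTensor H t, fun g => ?_, fun x h => ?_⟩
    · rw [map_add, evalAt, contract_lTensor, contract_lTensor, ← hs g, ← ht g]
      simp
    · rw [map_add, contract_lTensor, contract_lTensor, hs' x h, ht' x h]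
      ext <;> simp

/-- The zero module. -/
noncomputable def zeroObj (σ : AffineAction H A) : QCoh σ where
  carrier := PUnit
  ρ := 1
  equivariant _ _ _ := rfl
  rational_differential _ := ⟨0, fun _ => rfl, fun _ _ => rfl⟩

instance : HasZeroObject (QCoh σ) :=
  ⟨zeroObj σ, (IsZero.iff_id_eq_zero _).2 (by ext; rfl)⟩

instance : HasBinaryBiproducts (QCoh σ) where
  has_binary_biproduct M N :=
    hasBinaryBiproduct_of_total
      { pt := M.prod N
        fst := ⟨LinearMap.fst _ _ _, fun _ _ => rfl⟩
        snd := ⟨LinearMap.snd _ _ _, fun _ _ => rfl⟩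
        inl := ⟨LinearMap.inl _ _ _, fun g m => Prod.ext rfl (map_zero (N.ρ g)).symm⟩
        inr := ⟨LinearMap.inr _ _ _, fun g m => Prod.ext (map_zero (M.ρ g)).symm rfl⟩
        inl_fst := rfl
        inl_snd := rfl
        inr_fst := rfl
        inr_snd := rfl }
      (by ext m; exact Prod.ext (add_zero m.1) (zero_add m.2))

instance : HasFiniteProducts (QCoh σ) := hasFiniteProducts_of_has_binary_and_terminal

lemma ker_stable (f : M ⟶ N) : ∀ g, ∀ m ∈ LinearMap.ker f.lin, M.ρ g m ∈ LinearMap.ker f.lin := by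
  intro g m hm
  rw [LinearMap.mem_ker] at *
  rw [f.comm, hm, map_zero]

lemma range_stable (f : M ⟶ N) :
    ∀ g, ∀ m ∈ LinearMap.range f.lin, N.ρ g m ∈ LinearMap.range f.lin := by
  rintro g _ ⟨m, rfl⟩
  exact ⟨M.ρ g m, f.comm g m⟩

/-- Factorisation through an equivariant submodule. -/
noncomputable def subLift {K : QCoh σ} (S : Submodule (DiffOp A) M.carrier)
    (hS : ∀ g, ∀ m ∈ S, M.ρ g m ∈ S) (k : K ⟶ M) (hk : ∀ m, k.lin m ∈ S) : K ⟶ M.sub S hS :=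
  ⟨k.lin.codRestrict S hk, fun g m => Subtype.ext (k.comm g m)⟩

/-- Factorisation through a quotient. -/
noncomputable def quotDesc {K : QCoh σ} (S : Submodule (DiffOp A) M.carrier)
    (hS : ∀ g, ∀ m ∈ S, M.ρ g m ∈ S) (k : M ⟶ K) (hk : ∀ m ∈ S, k.lin m = 0) :
    M.quot S hS ⟶ K :=
  ⟨S.liftQ k.lin hk, fun g m => by
    obtain ⟨m, rfl⟩ := S.mkQ_surjective m
    exact k.comm g m⟩

lemma lin_eq_zero {K : QCoh σ} {f : M ⟶ N} {k : N ⟶ K} (h : f ≫ k = 0) (m : M.carrier) :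
    k.lin (f.lin m) = 0 := by
  rw [← comp_lin, h, zero_lin]

/-- Factorisation of a map that kills the kernel of a surjective map. -/
noncomputable def surjDesc {K : QCoh σ} (p : M ⟶ N) (hp : Function.Surjective p.lin) (k : M ⟶ K)
    (hk : ∀ m, p.lin m = 0 → k.lin m = 0) : N ⟶ K :=
  ⟨(Submodule.liftQ (LinearMap.ker p.lin) k.lin hk) ∘ₗ
      (p.lin.quotKerEquivOfSurjective hp).symm.toLinearMap, fun g n => by
    obtain ⟨m, rfl⟩ := hp n
    have e : ∀ m, (p.lin.quotKerEquivOfSurjective hp).symm (p.lin m) =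
        (LinearMap.ker p.lin).mkQ m := fun m => by
      rw [LinearEquiv.symm_apply_eq]; rfl
    rw [← p.comm]
    simp only [LinearMap.comp_apply, LinearEquiv.coe_coe, e]
    exact k.comm g m⟩

lemma surjDesc_fac {K : QCoh σ} (p : M ⟶ N) (hp : Function.Surjective p.lin) (k : M ⟶ K)
    (hk : ∀ m, p.lin m = 0 → k.lin m = 0) : p ≫ surjDesc p hp k hk = k := by
  ext m
  have e : (p.lin.quotKerEquivOfSurjective hp).symm (p.lin m) =
      (LinearMap.ker p.lin).mkQ m := by
    rw [LinearEquiv.symm_apply_eq]; rfl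
  change Submodule.liftQ (LinearMap.ker p.lin) k.lin hk
    ((p.lin.quotKerEquivOfSurjective hp).symm (p.lin m)) = _
  rw [e]
  rfl

/-- An injective map onto the kernel of `q` is a kernel of `q`. -/
noncomputable def isKernel (S : Submodule (DiffOp A) M.carrier)
    (hS : ∀ g, ∀ m ∈ S, M.ρ g m ∈ S) (q : M ⟶ N) (w : M.subι S hS ≫ q = 0)
    (h : ∀ m, q.lin m = 0 → m ∈ S) : IsLimit (KernelFork.ofι (M.subι S hS) w) :=
  KernelFork.IsLimit.ofι _ _ (fun k hk => subLift S hS k fun m => h _ (lin_eq_zero hk m))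
    (fun _ _ => rfl) (fun k hk l hl => by
      subst hl
      rfl)

/-- A surjective map is a cokernel of every map whose image is its kernel. -/
noncomputable def isCokernel {K : QCoh σ} (f : K ⟶ M) (p : M ⟶ N)
    (hp : Function.Surjective p.lin) (w : f ≫ p = 0)
    (h : ∀ m, p.lin m = 0 → m ∈ LinearMap.range f.lin) : IsColimit (CokernelCofork.ofπ p w) :=
  CokernelCofork.IsColimit.ofπ _ _
    (fun k hk => surjDesc p hp k fun m hm => by
      obtain ⟨n, rfl⟩ := h m hm
      exact lin_eq_zero hk n)
    (fun k hk => surjDesc_fac _ _ _ _)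
    (fun k hk l hl => by
      ext n
      obtain ⟨m, rfl⟩ := hp n
      rw [← comp_lin, hl, ← comp_lin, surjDesc_fac])

lemma quotπ_surjective (S : Submodule (DiffOp A) M.carrier)
    (hS : ∀ g, ∀ m ∈ S, M.ρ g m ∈ S) : Function.Surjective (M.quotπ S hS).lin :=
  S.mkQ_surjective

lemma quotπ_eq_zero_iff (S : Submodule (DiffOp A) M.carrier)
    (hS : ∀ g, ∀ m ∈ S, M.ρ g m ∈ S) (m : M.carrier) :
    (M.quotπ S hS).lin m = 0 ↔ m ∈ S := by
  have : m ∈ LinearMap.ker S.mkQ ↔ m ∈ S := by rw [Submodule.ker_mkQ]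
  exact this

/-- The projection of a module onto the image of a morphism. -/
noncomputable def toRange (f : M ⟶ N) : M ⟶ N.sub _ (range_stable f) :=
  subLift _ _ f fun m => LinearMap.mem_range_self _ m

lemma toRange_surjective (f : M ⟶ N) : Function.Surjective (toRange f).lin := by
  rintro ⟨_, m, hm⟩
  exact ⟨m, Subtype.ext hm⟩

lemma mem_range_kernel (f : M ⟶ N) (m : M.carrier) (hm : (toRange f).lin m = 0) :
    m ∈ LinearMap.range (M.subι _ (ker_stable f)).lin := by
  have h : f.lin m = 0 := congrArg Subtype.val hm
  exact ⟨⟨m, h⟩, rfl⟩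

lemma kernel_comp_toRange (f : M ⟶ N) : M.subι _ (ker_stable f) ≫ toRange f = 0 := by
  ext m
  have h : f.lin m.1 = 0 := m.2
  exact Subtype.ext h

noncomputable instance : Abelian (QCoh σ) :=
  Abelian.mk' fun M N f => ⟨
    { kernelFork := KernelFork.ofι (M.subι _ (ker_stable f)) (by ext m; exact m.2)
      isLimitKernelFork := isKernel _ _ _ _ fun _ hm => hm
      cokernelCofork := CokernelCofork.ofπ (N.quotπ _ (range_stable f))
        (by ext m; exact (quotπ_eq_zero_iff _ _ _).2 ⟨m, rfl⟩)
      isColimitCokernelCofork := isCokernel _ _ (quotπ_surjective _ _) _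
        fun m hm => (quotπ_eq_zero_iff _ _ _).1 hm
      image := N.sub _ (range_stable f)
      imageπ := toRange f
      ι_imageπ := kernel_comp_toRange f
      imageIsCokernel := isCokernel _ _ (toRange_surjective f) _ (mem_range_kernel f)
      imageι := N.subι _ (range_stable f)
      imageι_π := by ext m; exact (quotπ_eq_zero_iff _ _ _).2 m.2
      imageIsKernel := isKernel _ _ _ _ fun m hm => (quotπ_eq_zero_iff _ _ _).1 hm
      fac := rfl }⟩

/-- The `λ`-isotypic component `Γ(X, M)_λ`: the sum of all images of `G`-equivariant linear maps
`V → Γ(X, M)`, for `V` irreducible of class `λ`. -/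
noncomputable def isotypic (M : QCoh σ) (l : DominantWeight H) : Submodule ℂ M.carrier :=
  ⨆ (V : Irrep H) (_ : (⟦V⟧ : Quotient (irrepSetoid H)) = l)
    (f : Representation.IntertwiningMap V.ρ M.ρ), LinearMap.range f.toLinearMap

variable (σ) in
/-- The full subcategory `QCoh(𝒟_X, G)_U` of the modules `M` with `Γ(X, M)_λ = 0` for all
`λ ∈ U`. -/
def vanishing (U : Set (DominantWeight H)) : ObjectProperty (QCoh σ) :=
  fun M => ∀ l ∈ U, M.isotypic l = ⊥

end QCoh

end QCoh

/-! ### Quotient categories and recollements -/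

section Recollement

instance {C : Type*} [Category* C] [Abelian C] (P : ObjectProperty C) [P.IsSerreClass] :
    P.IsClosedUnderBinaryProducts where
  limitsOfShape_le := by
    rintro X ⟨p⟩
    refine P.prop_of_iso ?_
      (P.prop_biprod (p.prop_diag_obj (.mk .left)) (p.prop_diag_obj (.mk .right)))
    exact biprod.isoProd _ _ ≪≫ IsLimit.conePointUniqueUpToIso (prodIsProd _ _)
      ((IsLimit.postcomposeHomEquiv (diagramIsoPair p.diag) _).2 p.isLimit)

instance {C : Type*} [Category* C] [Abelian C] (P : ObjectProperty C) [P.IsSerreClass] :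
    P.IsClosedUnderFiniteProducts := .mk'

/-- The quotient of an abelian category by a Serre subcategory: the localization at the morphisms
whose kernel and cokernel lie in the subcategory. -/
abbrev SerreQuotient {C : Type*} [Category* C] [Abelian C] (P : ObjectProperty C)
    [P.IsSerreClass] :=
  P.isoModSerre.Localization

noncomputable instance {C : Type*} [Category* C] [Abelian C] (P : ObjectProperty C)
    [P.IsSerreClass] : Abelian (SerreQuotient P) :=
  ObjectProperty.SerreClassLocalization.abelian P.isoModSerre.Q P

/-- The quotient functor. -/
noncomputable abbrev quotientFunctor {C : Type*} [Category* C] [Abelian C] (P : ObjectProperty C)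
    [P.IsSerreClass] : C ⥤ SerreQuotient P :=
  P.isoModSerre.Q

/-- A recollement of abelian categories extending two given additive functors
`𝒜 ⥤ ℬ ⥤ 𝒞`. -/
structure Recollement {𝒜 ℬ 𝒞 : Type*} [Category* 𝒜] [Category* ℬ] [Category* 𝒞]
    [Abelian 𝒜] [Abelian ℬ] [Abelian 𝒞] (i : 𝒜 ⥤ ℬ) (j : ℬ ⥤ 𝒞) where
  additive_i : i.Additive
  additive_j : j.Additive
  /-- the left adjoint of `i` -/
  iL : ℬ ⥤ 𝒜
  /-- the right adjoint of `i` -/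
  iR : ℬ ⥤ 𝒜
  /-- the left adjoint of `j` -/
  jL : 𝒞 ⥤ ℬ
  /-- the right adjoint of `j` -/
  jR : 𝒞 ⥤ ℬ
  adj_iL : iL ⊣ i
  adj_iR : i ⊣ iR
  adj_jL : jL ⊣ j
  adj_jR : j ⊣ jR
  full_i : i.Full
  faithful_i : i.Faithful
  full_jL : jL.Full
  faithful_jL : jL.Faithful
  full_jR : jR.Full
  faithful_jR : jR.Faithful
  /-- The essential image of `i` is the kernel of `j`. -/
  essImage_iff : ∀ M : ℬ, i.essImage M ↔ IsZero (j.obj M)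

end Recollement

end EqDMod

/-! For a rational representation `V` of `G`, the induced module `𝒟(X) ⊗_{U(𝔤)} V` represents the
functor `M ↦ Hom_G(V, M)` on equivariant modules. Reductivity makes every rational representation
semisimple, so this functor is exact and the induced module is projective (`projective_induced`).
Hence the modules without `λ`-isotypic part for `λ ∈ U` are exactly those that receive no nonzero
map from a small family `F` of projectives (`vanishing_eq_rightOrthogonal`), and the theorem becomes
a statement about such right orthogonals in an abelian category with coproducts.

There, a morphism is an isomorphism modulo the orthogonal iff every `Hom(F t, -)` inverts it
(`isoModSerre_iff_bijective`). Objects `X` for which `Hom(X, -)` inverts these morphisms are called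
colocal; they are closed under coproducts and cokernels. Presenting an object by sums of the `F t`
gives a colocal approximation (`isoModSerre_colocalizationMap`), hence a fully faithful left adjoint
of the quotient functor.

The right adjoint comes from the special adjoint functor theorem, applied to the composite of the
quotient functor with its left adjoint. This is an endofunctor of the original category, so
coproducts in the quotient category need not be constructed. It preserves colimits because maps into
a coproduct are detected by their components, and the modules induced from all finite-dimensional
rational representations contain enough objects to separate morphisms
(`isSeparating_inducedFamily`). An adjoint triple with one fully faithful outer functor has both.

Finally, the inclusion of the orthogonal has as left adjoint the cokernel of the sum of all maps `F
t ⟶ X`, and as right adjoint the kernel of the unit of the right adjunction. -/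

namespace EqDMod

/-! ### Right orthogonals of families of projectives, and colocal approximation -/

section ProjectiveOrthogonal

universe v w

variable {C : Type w} [Category.{v} C] [Abelian C] {T : Type v} (F : T → C)

/-- The objects that receive only the zero morphism from each member of a family. -/
def rightOrthogonal : ObjectProperty C := fun X => ∀ t (f : F t ⟶ X), f = 0

variable [∀ t, Projective (F t)]

instance isSerreClass_rightOrthogonal : (rightOrthogonal F).IsSerreClass where
  exists_zero := ⟨_, isZero_zero C, fun _ _ => (isZero_zero C).eq_of_tgt _ _⟩
  prop_of_mono i _ h t f := by
    rw [← cancel_mono i, h t (f ≫ i), zero_comp]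
  prop_of_epi p _ h t f := by
    rw [← Projective.factorThru_comp f p, h t (Projective.factorThru f p), zero_comp]
  prop_X₂_of_shortExact {S} hS h₁ h₃ t f := by
    have := hS.mono_f
    have e := hS.exact.lift_f f (h₃ t _)
    rw [← e, h₁ t (hS.exact.lift f (h₃ t _)), zero_comp]

variable {F}

/-- Exactness of `Hom(F t, -)`: it sends the kernel and cokernel of `f` to those of composition with
`f`, so both vanish together. -/
lemma isoModSerre_iff_bijective {X Y : C} (f : X ⟶ Y) :
    (rightOrthogonal F).isoModSerre f ↔
      ∀ t, Function.Bijective fun g : F t ⟶ X => g ≫ f := by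
  refine ⟨fun hf t => ⟨fun a b hab => ?_, fun h => ?_⟩, fun hf => ⟨fun t g => ?_, fun t g => ?_⟩⟩
  · have e : (a - b) ≫ f = 0 := by rw [Preadditive.sub_comp, sub_eq_zero]; exact hab
    rw [← sub_eq_zero, ← kernel.lift_ι f _ e, hf.1 t (kernel.lift f _ e), zero_comp]
  · have e : h ≫ cokernel.π f = 0 := hf.2 t _
    -- As `h` dies in the cokernel, it lands in the image of `f`; projectivity lifts it along the
    -- epimorphism from `X` onto that image.
    refine ⟨Projective.factorThru (kernel.lift _ h e) (Abelian.factorThruImage f), ?_⟩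
    refine (congrArg (_ ≫ ·) (Abelian.image.fac f).symm).trans ?_
    refine (Category.assoc _ _ _).symm.trans ?_
    rw [Projective.factorThru_comp]
    exact kernel.lift_ι _ _ _
  · rw [← cancel_mono (kernel.ι f), zero_comp]
    apply (hf t).1
    simp
  · obtain ⟨k, hk⟩ := (hf t).2 (Projective.factorThru g (cokernel.π f))
    rw [← Projective.factorThru_comp g (cokernel.π f), ← hk]
    simp

/-- An object `X` such that `Hom(X, -)` inverts the isomorphisms modulo the orthogonal. -/
abbrev IsColocalObj (F : T → C) [∀ t, Projective (F t)] (X : C) : Prop :=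
  ∀ ⦃Y Z : C⦄ (f : Y ⟶ Z), (rightOrthogonal F).isoModSerre f →
    Function.Bijective fun g : X ⟶ Y => g ≫ f

lemma isColocalObj_self (t : T) : IsColocalObj F (F t) :=
  fun _ _ f hf => (isoModSerre_iff_bijective f).1 hf t

lemma IsColocalObj.cokernel {X Y : C} (d : X ⟶ Y) (hX : IsColocalObj F X)
    (hY : IsColocalObj F Y) : IsColocalObj F (cokernel d) := by
  refine fun Z W f hf => ⟨fun a b hab => ?_, fun h => ?_⟩
  · rw [← cancel_epi (cokernel.π d)]
    apply (hY f hf).1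
    simpa using congrArg (cokernel.π d ≫ ·) hab
  · obtain ⟨k, hk⟩ := (hY f hf).2 (cokernel.π d ≫ h)
    have e : d ≫ k = 0 := by
      apply (hX f hf).1
      simp only at hk
      simp [hk]
    refine ⟨cokernel.desc d k e, ?_⟩
    rw [← cancel_epi (cokernel.π d)]
    simpa using hk

/-- Yoneda among colocal objects: the preimage of `𝟙 Y` is a section of `f`, and uniqueness of lifts
from `X` makes it a two-sided inverse. -/
lemma IsColocalObj.isIso {X Y : C} (hX : IsColocalObj F X) (hY : IsColocalObj F Y) {f : X ⟶ Y}
    (hf : (rightOrthogonal F).isoModSerre f) : IsIso f := by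
  obtain ⟨g, hg⟩ := (hY f hf).2 (𝟙 Y)
  exact ⟨g, (hX f hf).1 (by simp only at hg; simp [hg]), hg⟩

variable [HasCoproducts.{v} C]

lemma IsColocalObj.sigma {J : Type v} (X : J → C) (hX : ∀ j, IsColocalObj F (X j)) :
    IsColocalObj F (∐ X) := by
  refine fun Z W f hf => ⟨fun a b hab => ?_, fun h => ?_⟩
  · refine Sigma.hom_ext _ _ fun j => (hX j f hf).1 ?_
    simpa using congrArg (Sigma.ι X j ≫ ·) hab
  · choose k hk using fun j => (hX j f hf).2 (Sigma.ι X j ≫ h)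
    refine ⟨Sigma.desc k, Sigma.hom_ext _ _ fun j => ?_⟩
    simpa using hk j

variable (F)

/-- The sum of one copy of `F t` for each morphism `F t ⟶ X`. -/
noncomputable abbrev cover (X : C) : C := ∐ fun p : Σ t, F t ⟶ X => F p.1

/-- The tautological morphism. -/
noncomputable abbrev coverMap (X : C) : cover F X ⟶ X := Sigma.desc fun p => p.2

variable {F}

omit [Abelian C] [∀ t, Projective (F t)] in
lemma ι_coverMap {X : C} {t : T} (f : F t ⟶ X) :
    Sigma.ι (fun p : Σ t, F t ⟶ X => F p.1) ⟨t, f⟩ ≫ coverMap F X = f := by simp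

lemma isColocalObj_cover (X : C) : IsColocalObj F (cover F X) :=
  .sigma _ fun p => isColocalObj_self p.1

omit [∀ t, Projective (F t)] in
lemma coverMap_comp_eq_zero {X Y : C} (hY : rightOrthogonal F Y) (f : X ⟶ Y) :
    coverMap F X ≫ f = 0 :=
  Sigma.hom_ext _ _ fun p => by simpa using hY p.1 (p.2 ≫ f)

/-- By projectivity a map from `F t` to the cokernel lifts to `X`, where it is a component of
`coverMap` and so dies. This is the quotient of `X` that the left adjoint of the inclusion uses. -/
lemma rightOrthogonal_cokernel_coverMap (X : C) : rightOrthogonal F (cokernel (coverMap F X)) := by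
  intro t g
  rw [← Projective.factorThru_comp g (cokernel.π _),
    ← ι_coverMap (Projective.factorThru g (cokernel.π (coverMap F X))), Category.assoc,
    cokernel.condition, comp_zero]

variable (F)

/-- The relations between the generators `cover F X` of `X`. -/
noncomputable abbrev coverRel (X : C) : cover F (kernel (coverMap F X)) ⟶ cover F X :=
  coverMap F _ ≫ kernel.ι (coverMap F X)

/-- The colocal approximation of `X`. -/
noncomputable abbrev colocalization (X : C) : C := cokernel (coverRel F X)

/-- The projection of the colocal approximation. -/
noncomputable abbrev colocalizationMap (X : C) : colocalization F X ⟶ X :=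
  cokernel.desc _ (coverMap F X) (by simp [coverRel])

variable {F}

lemma isColocalObj_colocalization (X : C) : IsColocalObj F (colocalization F X) :=
  .cokernel _ (isColocalObj_cover _) (isColocalObj_cover _)

/-- Every `F t ⟶ X` is the restriction of `coverMap` to a summand, which gives surjectivity on
`Hom(F t, -)`. For injectivity, a map killed in `X` lifts to the cover, lands in the kernel of
`coverMap`, and is therefore itself one of the relations. -/
lemma isoModSerre_colocalizationMap (X : C) :
    (rightOrthogonal F).isoModSerre (colocalizationMap F X) := by
  rw [isoModSerre_iff_bijective]
  refine fun t => ⟨fun a b hab => ?_, fun h => ?_⟩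
  · rw [← sub_eq_zero]
    have e : (a - b) ≫ colocalizationMap F X = 0 := by
      rw [Preadditive.sub_comp, sub_eq_zero]; exact hab
    generalize a - b = c at e
    have hc := Projective.factorThru_comp c (cokernel.π (coverRel F X))
    generalize Projective.factorThru c (cokernel.π (coverRel F X)) = k at hc
    have hk : k ≫ coverMap F X = 0 := by
      rw [← e, ← hc, Category.assoc, cokernel.π_desc]
    have : k = Sigma.ι (fun p : Σ t, F t ⟶ kernel (coverMap F X) => F p.1)
        ⟨t, kernel.lift _ k hk⟩ ≫ coverRel F X := by
      rw [coverRel, ← Category.assoc, ι_coverMap, kernel.lift_ι]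
    rw [← hc, this, Category.assoc, cokernel.condition, comp_zero]
  · refine ⟨Sigma.ι (fun p : Σ t, F t ⟶ X => F p.1) ⟨t, h⟩ ≫ cokernel.π _, ?_⟩
    simp

end ProjectiveOrthogonal

/-! ### Adjoints of the quotient functor and the abstract recollement -/

section Quotient

universe v w

variable {C : Type w} [Category.{v} C] [Abelian C] {T : Type v} {F : T → C}
  [∀ t, Projective (F t)]

/-- In the calculus of left fractions a morphism out of `X` is `s⁻¹` after some `f`, with `s`
inverted by `Hom(X, -)`; so `f` factors uniquely through `s` and the denominator disappears. -/
lemma IsColocalObj.map_bijective {X : C} (hX : IsColocalObj F X) (Y : C) :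
    Function.Bijective fun f : X ⟶ Y => (quotientFunctor (rightOrthogonal F)).map f := by
  refine ⟨fun f g hfg => ?_, fun h => ?_⟩
  · obtain ⟨Z, s, hs, e⟩ := (MorphismProperty.map_eq_iff_postcomp
      (quotientFunctor (rightOrthogonal F)) (rightOrthogonal F).isoModSerre f g).1 hfg
    exact (hX s hs).1 e
  · obtain ⟨φ, rfl⟩ := Localization.exists_leftFraction
      (quotientFunctor (rightOrthogonal F)) (rightOrthogonal F).isoModSerre h
    obtain ⟨k, hk⟩ := (hX φ.s φ.hs).2 φ.f
    refine ⟨k, ?_⟩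
    have := Localization.inverts (quotientFunctor (rightOrthogonal F))
      (rightOrthogonal F).isoModSerre φ.s φ.hs
    rw [← cancel_mono ((quotientFunctor (rightOrthogonal F)).map φ.s),
      MorphismProperty.LeftFraction.map_comp_map_s, ← hk, Functor.map_comp]

variable [HasCoproducts.{v} C]

variable (F)

/-- The quotient functor identifies the colocal approximation of `X` with `X`. -/
noncomputable def quotientColocalizationIso (X : C) :
    (quotientFunctor (rightOrthogonal F)).obj (colocalization F X) ≅
      (quotientFunctor (rightOrthogonal F)).obj X :=
  Localization.isoOfHom _ _ _ (isoModSerre_colocalizationMap X)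

variable {F}

/-- The universal property of the colocal approximation. -/
noncomputable def colocalizationHomEquiv (X : SerreQuotient (rightOrthogonal F)) (Y : C) :
    (colocalization F ((quotientFunctor (rightOrthogonal F)).objPreimage X) ⟶ Y) ≃
      (X ⟶ (quotientFunctor (rightOrthogonal F)).obj Y) :=
  (Equiv.ofBijective _ ((isColocalObj_colocalization _).map_bijective Y)).trans
    (((quotientColocalizationIso F _) ≪≫
      (quotientFunctor (rightOrthogonal F)).objObjPreimageIso X).homFromEquiv)

lemma colocalizationHomEquiv_apply (X : SerreQuotient (rightOrthogonal F)) (Y : C)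
    (f : colocalization F ((quotientFunctor (rightOrthogonal F)).objPreimage X) ⟶ Y) :
    colocalizationHomEquiv X Y f = ((quotientColocalizationIso F _) ≪≫
      (quotientFunctor (rightOrthogonal F)).objObjPreimageIso X).inv ≫
        (quotientFunctor (rightOrthogonal F)).map f := rfl

lemma colocalizationHomEquiv_comp (X : SerreQuotient (rightOrthogonal F)) (Y Y' : C) (g : Y ⟶ Y')
    (f : colocalization F ((quotientFunctor (rightOrthogonal F)).objPreimage X) ⟶ Y) :
    colocalizationHomEquiv X Y' (f ≫ g) =
      colocalizationHomEquiv X Y f ≫ (quotientFunctor (rightOrthogonal F)).map g := by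
  simp only [colocalizationHomEquiv_apply, Functor.map_comp, Category.assoc]

variable (F)

/-- The left adjoint of the quotient functor. -/
noncomputable def quotientLeftAdjoint : SerreQuotient (rightOrthogonal F) ⥤ C :=
  Adjunction.leftAdjointOfEquiv colocalizationHomEquiv colocalizationHomEquiv_comp

/-- The adjunction between `quotientLeftAdjoint` and the quotient functor. -/
noncomputable def quotientLeftAdjunction :
    quotientLeftAdjoint F ⊣ quotientFunctor (rightOrthogonal F) :=
  Adjunction.adjunctionOfEquivLeft colocalizationHomEquiv colocalizationHomEquiv_comp

/-- Each component of the unit is the image of an identity under `colocalizationHomEquiv`, which is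
the inverse of the isomorphism identifying an object with its colocal approximation. -/
instance : IsIso (quotientLeftAdjunction F).unit := by
  have : ∀ X, IsIso ((quotientLeftAdjunction F).unit.app X) := fun X => by
    have e : (quotientLeftAdjunction F).unit.app X = colocalizationHomEquiv X _ (𝟙 _) := by
      simp [quotientLeftAdjunction]
      rfl
    have h : IsIso (colocalizationHomEquiv X _ (𝟙 _)) := by
      rw [colocalizationHomEquiv_apply, CategoryTheory.Functor.map_id, Category.comp_id]
      infer_instance
    exact e ▸ h
  exact NatIso.isIso_of_isIso_app _

/-- The left adjoint of the quotient functor is fully faithful. -/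
noncomputable def fullyFaithfulQuotientLeftAdjoint : (quotientLeftAdjoint F).FullyFaithful :=
  (quotientLeftAdjunction F).fullyFaithfulLOfIsIsoUnit

variable {F}

lemma isColocalObj_quotientLeftAdjoint (X : SerreQuotient (rightOrthogonal F)) :
    IsColocalObj F ((quotientLeftAdjoint F).obj X) :=
  isColocalObj_colocalization _

/-- The unit is invertible, so the triangle identity shows that the quotient functor inverts the
counit. -/
lemma isoModSerre_counit (X : C) :
    (rightOrthogonal F).isoModSerre ((quotientLeftAdjunction F).counit.app X) := by
  rw [← ObjectProperty.SerreClassLocalization.isIso_map_iff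
    (quotientFunctor (rightOrthogonal F)) (rightOrthogonal F)]
  refine (isIso_comp_left_iff ((quotientLeftAdjunction F).unit.app _) _).1 ?_
  rw [(quotientLeftAdjunction F).right_triangle_components X]
  exact IsIso.id _

variable (F) in
/-- The idempotent comonad of the adjunction. -/
noncomputable abbrev colocalizationFunctor : C ⥤ C :=
  quotientFunctor (rightOrthogonal F) ⋙ quotientLeftAdjoint F

/-! ### Colimit preservation by the comonad and the adjoint functor theorem -/

section Coproducts

variable (hC : ∀ {J : Type v} [DecidableEq J] (X : J → C) {Y : C} (f : Y ⟶ ∐ X),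
  (∀ j, f ≫ Sigma.π X j = 0) → f = 0)
include hC

/-- Since components detect maps into a coproduct, the kernel can be tested coordinatewise and the
orthogonal is closed under coproducts. The cokernel of the sum is a quotient of the sum of the
cokernels, so it lies in the orthogonal too. -/
lemma isoModSerre_sigma_map {J : Type v} {X Y : J → C} (f : ∀ j, X j ⟶ Y j)
    (hf : ∀ j, (rightOrthogonal F).isoModSerre (f j)) :
    (rightOrthogonal F).isoModSerre (Limits.Sigma.map f) := by
  classical
  refine ⟨fun t g => ?_, fun t g => ?_⟩
  · rw [← cancel_mono (kernel.ι _), zero_comp]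
    refine hC _ _ fun j => ((isoModSerre_iff_bijective _).1 (hf j) t).1 ?_
    have e : Sigma.π X j ≫ f j = Limits.Sigma.map f ≫ Sigma.π Y j := by
      refine Sigma.hom_ext _ _ fun i => ?_
      by_cases h : i = j
      · subst h; simp
      · simp [Sigma.ι_π_of_ne_assoc _ h, Sigma.ι_π_of_ne _ h]
    simp [e]
  · have w : ∀ j, f j ≫ Sigma.ι Y j ≫ cokernel.π (Limits.Sigma.map f) = 0 := fun j => by
      rw [← Category.assoc, ← Sigma.ι_map, Category.assoc, cokernel.condition, comp_zero]
    have : Epi (Limits.Sigma.desc fun j => cokernel.desc (f j) _ (w j)) := by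
      refine ⟨fun a b hab => ?_⟩
      rw [← cancel_epi (cokernel.π _)]
      refine Sigma.hom_ext _ _ fun j => ?_
      simpa using congrArg (fun k => cokernel.π (f j) ≫
        Sigma.ι (fun j => cokernel (f j)) j ≫ k) hab
    refine (rightOrthogonal F).prop_of_epi
      (Limits.Sigma.desc fun j => cokernel.desc (f j) _ (w j)) (fun s h => ?_) t g
    exact hC _ _ fun j => (hf j).2 s _

/-- Both sides are colocal, so it suffices that the comparison be an isomorphism modulo the
orthogonal. Followed by the counit it becomes a sum of counits, and two-out-of-three applies. -/
lemma isIso_sigmaComparison_colocalizationFunctor {J : Type v} (X : J → C) :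
    IsIso (sigmaComparison (colocalizationFunctor F) X) := by
  refine IsColocalObj.isIso (.sigma _ fun j => isColocalObj_quotientLeftAdjoint _)
    (isColocalObj_quotientLeftAdjoint _) ?_
  refine (rightOrthogonal F).isoModSerre.of_postcomp _
    ((quotientLeftAdjunction F).counit.app (∐ X)) (isoModSerre_counit _) ?_
  have e : sigmaComparison (colocalizationFunctor F) X ≫
      (quotientLeftAdjunction F).counit.app (∐ X) =
        Limits.Sigma.map fun j => (quotientLeftAdjunction F).counit.app (X j) := by
    refine Sigma.hom_ext _ _ fun j => ?_
    simp only [ι_comp_sigmaComparison_assoc, Sigma.ι_map]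
    exact (quotientLeftAdjunction F).counit.naturality _
  rw [e]
  exact isoModSerre_sigma_map hC _ fun j => isoModSerre_counit _

/-- Colimits are built from coproducts, treated above, and coequalizers, which the exact quotient
functor and its left adjoint both preserve. -/
lemma preservesColimits_colocalizationFunctor :
    PreservesColimitsOfSize.{v, v} (colocalizationFunctor F) := by
  have h₁ : ∀ J : Type v, PreservesColimitsOfShape (Discrete J) (colocalizationFunctor F) := by
    intro J
    have (X : J → C) : PreservesColimit (Discrete.functor X) (colocalizationFunctor F) := by
      have := isIso_sigmaComparison_colocalizationFunctor (F := F) hC X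
      exact PreservesCoproduct.of_iso_comparison _ _
    exact preservesColimitsOfShape_of_discrete _
  have h₂ : PreservesFiniteColimits (quotientFunctor (rightOrthogonal F)) :=
    ObjectProperty.SerreClassLocalization.preservesFiniteColimits _ (rightOrthogonal F)
  have h₃ : PreservesColimitsOfShape WalkingParallelPair (quotientLeftAdjoint F) :=
    (quotientLeftAdjunction F).leftAdjoint_preservesColimits.preservesColimitsOfShape
  have : HasCoequalizers C := inferInstance
  exact ⟨preservesColimit_of_preservesCoequalizers_and_coproduct _⟩

/-- The special adjoint functor theorem. The separating family `F'` is independent of `F`, which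
need not separate; it also yields well-poweredness, as it detects isomorphisms. -/
lemma isLeftAdjoint_colocalizationFunctor {T' : Type v} {F' : T' → C}
    (hF' : (ObjectProperty.ofObj F').IsSeparating) : (colocalizationFunctor F).IsLeftAdjoint := by
  have := preservesColimits_colocalizationFunctor (F := F) hC
  have : HasColimits C := has_colimits_of_hasCoequalizers_and_coproducts
  have : WellPowered.{v} C := wellPowered_of_isDetecting hF'.isDetecting
  exact isLeftAdjoint_of_preservesColimits_of_isSeparating hF' _

end Coproducts

/-- A right adjoint of the quotient functor, obtained from one of the comonad. -/
noncomputable def quotientRightAdjunction [(colocalizationFunctor F).IsLeftAdjoint] :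
    quotientFunctor (rightOrthogonal F) ⊣
      quotientLeftAdjoint F ⋙ (colocalizationFunctor F).rightAdjoint :=
  (Adjunction.ofIsLeftAdjoint (colocalizationFunctor F)).restrictFullyFaithful
    (iC := 𝟭 C) (iD := quotientLeftAdjoint F) (.id C) (fullyFaithfulQuotientLeftAdjoint F)
    (Iso.refl _) (Iso.refl _)

/-- The universal property of the largest quotient of `X` in the orthogonal. -/
noncomputable def cokernelCoverHomEquiv (X : C) (Y : (rightOrthogonal F).FullSubcategory) :
    ((⟨_, rightOrthogonal_cokernel_coverMap X⟩ : (rightOrthogonal F).FullSubcategory) ⟶ Y) ≃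
      (X ⟶ Y.obj) where
  toFun f := cokernel.π (coverMap F X) ≫ f.hom
  invFun g := ObjectProperty.homMk (cokernel.desc _ g (coverMap_comp_eq_zero Y.property g))
  left_inv f := by
    ext
    simp
  right_inv g := by simp

variable (F) in
/-- The left adjoint of the inclusion of the orthogonal. -/
noncomputable def inclusionLeftAdjunction :
    Adjunction.leftAdjointOfEquiv (G := (rightOrthogonal F).ι) cokernelCoverHomEquiv
      (fun _ _ _ _ _ => (Category.assoc _ _ _).symm) ⊣ (rightOrthogonal F).ι :=
  Adjunction.adjunctionOfEquivLeft _ _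

section

variable {G : SerreQuotient (rightOrthogonal F) ⥤ C}
  (adj : quotientFunctor (rightOrthogonal F) ⊣ G)

-- Full faithfulness passes across the adjoint triple to the right adjoint, so its counit is
-- invertible. By the triangle identity the quotient functor then inverts the unit.
include adj in
lemma rightOrthogonal_kernel_unit (X : C) :
    (rightOrthogonal F) (kernel (adj.unit.app X)) := by
  have := ((Adjunction.Triple.mk (quotientLeftAdjunction F) adj).fullyFaithfulEquiv
    (fullyFaithfulQuotientLeftAdjoint F)).full
  have := ((Adjunction.Triple.mk (quotientLeftAdjunction F) adj).fullyFaithfulEquiv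
    (fullyFaithfulQuotientLeftAdjoint F)).faithful
  have h : IsIso ((quotientFunctor (rightOrthogonal F)).map (adj.unit.app X)) := by
    refine (isIso_comp_right_iff _ (adj.counit.app _)).1 ?_
    have := adj.left_triangle_components X
    rw [this]
    exact IsIso.id _
  exact ((ObjectProperty.SerreClassLocalization.isIso_map_iff
    (quotientFunctor (rightOrthogonal F)) (rightOrthogonal F) _).1 h).1

-- By adjunction the composite corresponds to a morphism out of the image of `X` in the quotient
-- category, which is zero.
omit [HasCoproducts.{v} C] in
lemma comp_unit_eq_zero {X Y : C} (hX : rightOrthogonal F X) (f : X ⟶ Y) :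
    f ≫ adj.unit.app Y = 0 := by
  have h : IsZero ((quotientFunctor (rightOrthogonal F)).obj X) :=
    (ObjectProperty.SerreClassLocalization.isZero_obj_iff _ (rightOrthogonal F) X).2 hX
  refine (adj.homEquiv _ _).symm.injective (h.eq_of_src _ _)

/-- The universal property of the largest subobject of `Y` in the orthogonal. -/
noncomputable def kernelUnitHomEquiv (X : (rightOrthogonal F).FullSubcategory) (Y : C) :
    (X.obj ⟶ Y) ≃ (X ⟶ (⟨_, rightOrthogonal_kernel_unit adj Y⟩ :
      (rightOrthogonal F).FullSubcategory)) where
  toFun f := ObjectProperty.homMk (kernel.lift _ f (comp_unit_eq_zero adj X.property f))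
  invFun g := g.hom ≫ kernel.ι _
  left_inv f := by simp
  right_inv g := by
    ext
    simp

/-- The right adjoint of the inclusion of the orthogonal. -/
noncomputable def inclusionRightAdjunction :
    (rightOrthogonal F).ι ⊣ Adjunction.rightAdjointOfEquiv (F := (rightOrthogonal F).ι)
      (kernelUnitHomEquiv adj) (fun X' X Y f g => by
        ext
        simp [kernelUnitHomEquiv]) :=
  Adjunction.adjunctionOfEquivRight _ _

end

lemma nonempty_recollement_rightOrthogonal
    (hC : ∀ {J : Type v} [DecidableEq J] (X : J → C) {Y : C} (f : Y ⟶ ∐ X),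
      (∀ j, f ≫ Sigma.π X j = 0) → f = 0) {T' : Type v} {F' : T' → C}
    (hF' : (ObjectProperty.ofObj F').IsSeparating) :
    Nonempty (Recollement (rightOrthogonal F).ι (quotientFunctor (rightOrthogonal F))) := by
  have := isLeftAdjoint_colocalizationFunctor (F := F) hC hF'
  have h := (Adjunction.Triple.mk (quotientLeftAdjunction F)
    quotientRightAdjunction).fullyFaithfulEquiv (fullyFaithfulQuotientLeftAdjoint F)
  exact ⟨{
    additive_i := inferInstance
    additive_j := inferInstance
    iL := _
    iR := _
    jL := _
    jR := _
    adj_iL := inclusionLeftAdjunction F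
    adj_iR := inclusionRightAdjunction quotientRightAdjunction
    adj_jL := quotientLeftAdjunction F
    adj_jR := quotientRightAdjunction
    full_i := inferInstance
    faithful_i := inferInstance
    full_jL := (fullyFaithfulQuotientLeftAdjoint F).full
    faithful_jL := (fullyFaithfulQuotientLeftAdjoint F).faithful
    full_jR := h.full
    faithful_jR := h.faithful
    essImage_iff := fun M => by
      rw [ObjectProperty.SerreClassLocalization.isZero_obj_iff _ (rightOrthogonal F) M]
      exact ⟨fun ⟨N, ⟨e⟩⟩ => (rightOrthogonal F).prop_of_iso e N.property,
        fun hM => (rightOrthogonal F).ι.obj_mem_essImage ⟨M, hM⟩⟩ }⟩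

end Quotient

/-! ### Regular functions and tangent vectors on `G` -/

section Points

variable {H : Type u} [CommRing H] [HopfAlgebra ℂ H]

lemma contract_rTensor (φ : H →ₗ[ℂ] ℂ) {V : Type*} [AddCommGroup V] [Module ℂ V]
    (f : H →ₗ[ℂ] H) (t : H ⊗[ℂ] V) :
    contract φ V (f.rTensor V t) = contract (φ ∘ₗ f) V t := by
  induction t with
  | zero => simp
  | tmul h v => simp
  | add s t hs ht => simp [hs, ht]

/-- Points separate the functions on a reduced affine variety over `ℂ`. -/
lemma eq_zero_of_forall_algHom {R : Type*} [CommRing R] [Algebra ℂ R] [Algebra.FiniteType ℂ R]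
    [IsReduced R] (r : R) (hr : ∀ g : R →ₐ[ℂ] ℂ, g r = 0) : r = 0 := by
  have : IsJacobsonRing R := isJacobsonRing_of_finiteType (A := ℂ)
  -- Nullstellensatz: each residue field is finite over `ℂ`, hence equal to `ℂ`, so every maximal
  -- ideal is the kernel of a point.
  have hmem : r ∈ (⊥ : Ideal R).jacobson := by
    rw [Ideal.jacobson, Ideal.mem_sInf]
    rintro m ⟨-, hm⟩
    let := Ideal.Quotient.field m
    have : Module.Finite ℂ (R ⧸ m) := finite_of_finite_type_of_isJacobsonRing ℂ (R ⧸ m)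
    let e : ℂ ≃ₐ[ℂ] R ⧸ m := AlgEquiv.ofBijective (Algebra.ofId ℂ _)
      IsAlgClosed.algebraMap_bijective_of_isIntegral
    have h := hr (e.symm.toAlgHom.comp (Ideal.Quotient.mkₐ ℂ m))
    have h' : e.symm (Ideal.Quotient.mk m r) = 0 := h
    rwa [map_eq_zero_iff _ e.symm.injective, Ideal.Quotient.eq_zero_iff_mem] at h'
  rw [← Ideal.radical_eq_jacobson] at hmem
  obtain ⟨n, hn⟩ := hmem
  exact eq_zero_of_pow_eq_zero hn

/-- A regular function on `G` is determined by its values. -/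
lemma evalAt_injective [Algebra.FiniteType ℂ H] [IsReduced H] {V : Type*} [AddCommGroup V]
    [Module ℂ V] {s t : H ⊗[ℂ] V} (h : ∀ g : Pt H, evalAt g V s = evalAt g V t) : s = t := by
  classical
  rw [← sub_eq_zero]
  replace h : ∀ g : Pt H, evalAt g V (s - t) = 0 := fun g => by rw [map_sub, h, sub_self]
  generalize s - t = r at h
  let b := Module.Basis.ofVectorSpace ℂ V
  -- Against a basis of `V`, the coefficients in `H` are scalar functions vanishing at all points.
  obtain ⟨c, rfl⟩ := TensorProduct.eq_repr_basis_right b r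
  have hc : ∀ i, c i = 0 := fun i => eq_zero_of_forall_algHom _ fun g => by
    have e := congrArg (b.repr · i) (h (WithConv.toConv g))
    simp only [Finsupp.sum, map_sum, contract_tmul, map_smul, Module.Basis.repr_self] at e
    by_cases hne : c i = 0
    · rw [hne, map_zero]
    · simpa [Finsupp.single_apply, hne] using e
  exact Finset.sum_eq_zero fun i _ => by simp [hc i]

lemma IsTangent.map_one {x : H →ₗ[ℂ] ℂ} (hx : IsTangent H x) : x 1 = 0 := by
  have := hx 1 1
  simp at this
  exact this

/-- Differentiate `g⁻¹ g = 1`: apply `x` to the antipode axiom and expand by the Leibniz rule, using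
that `x` kills constants. -/
lemma IsTangent.comp_antipode {x : H →ₗ[ℂ] ℂ} (hx : IsTangent H x) :
    x ∘ₗ HopfAlgebra.antipode ℂ = -x := by
  ext h
  have key : ∀ t : H ⊗[ℂ] H, x (LinearMap.mul' ℂ H ((HopfAlgebra.antipode ℂ).rTensor H t)) =
      x (contract (Coalgebra.counit (R := ℂ)) H t) + (x ∘ₗ HopfAlgebra.antipode ℂ)
        (TensorProduct.rid ℂ H ((Coalgebra.counit (R := ℂ)).lTensor H t)) := by
    intro t
    induction t with
    | zero => simp
    | tmul a b => simp [hx _ _]; ring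
    | add s t hs ht => simp only [map_add, hs, ht]; ring
  have e := key (Coalgebra.comul h)
  have e₁ : contract (Coalgebra.counit (R := ℂ)) H (Coalgebra.comul h) = h := by
    simp [contract]
  rw [HopfAlgebra.mul_antipode_rTensor_comul_apply, e₁, Coalgebra.lTensor_counit_comul,
    Algebra.algebraMap_eq_smul_one, map_smul, hx.map_one] at e
  simp at e
  simp
  linear_combination -e

end Points

/-! ### Differential operators of bounded order are determined by finitely many values -/

section DiffOpFinite

variable {A : Type u} [CommRing A] [Algebra ℂ A]

lemma IsDiffOp.smul {n : ℕ} {P : Module.End ℂ A} (hP : IsDiffOp A n P) (c : ℂ) :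
    IsDiffOp A n (c • P) := by
  induction n generalizing P with
  | zero => simp only [IsDiffOp] at *; simp [hP]
  | succ n ih =>
    intro a
    convert ih (hP a) using 1
    rw [smul_sub, smul_mul_assoc, mul_smul_comm]

/-- A differential operator of bounded order is determined by its values on a finite set. -/
lemma exists_finset_isDiffOp_eq_zero [Algebra.FiniteType ℂ A] (n : ℕ) :
    ∃ B : Finset A, ∀ P, IsDiffOp A n P → (∀ b ∈ B, P b = 0) → P = 0 := by
  classical
  obtain ⟨s, hs⟩ := Algebra.FiniteType.out (R := ℂ) (A := A)
  induction n with
  | zero => exact ⟨∅, fun P hP _ => hP⟩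
  | succ n ih =>
    obtain ⟨B, hB⟩ := ih
    -- For a generator `a ∈ s`, the values of `[P, a]` on `B` involve only those of `P` on `B` and
    -- `a * B`. So all these commutators vanish, `P` is `A`-linear, and the value at `1` settles it.
    refine ⟨insert 1 (B ∪ (s ×ˢ B).image fun p => p.1 * p.2), fun P hP h => ?_⟩
    have h₁ : ∀ a ∈ s, ∀ c, P (a * c) = a * P c := fun a ha c => by
      have := hB _ (hP a) fun b hb => by
        have hb₁ : P b = 0 := h b (by simp [hb])
        have hb₂ : P (a * b) = 0 := h _ <| Finset.mem_insert_of_mem <| Finset.mem_union_right _ <|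
          Finset.mem_image.2 ⟨(a, b), Finset.mem_product.2 ⟨ha, hb⟩, rfl⟩
        simp [hb₁, hb₂]
      simpa [sub_eq_zero] using congrArg (· c) this
    have h₂ : ∀ a, ∀ c, P (a * c) = a * P c := fun a => by
      have ha : a ∈ Algebra.adjoin ℂ (s : Set A) := hs ▸ Algebra.mem_top
      induction ha using Algebra.adjoin_induction with
      | mem a ha => exact h₁ a ha
      | algebraMap r => intro c; simp [← Algebra.smul_def]
      | add a b _ _ ha hb => intro c; simp [add_mul, ha, hb]
      | mul a b _ _ ha hb => intro c; simp [mul_assoc, ha, hb]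
    ext a
    have := h₂ a 1
    rw [mul_one, h 1 (by simp), mul_zero] at this
    exact this

variable (A) in
/-- Differential operators of order `< n`. -/
def diffOpFiltration (n : ℕ) : Submodule ℂ (DiffOp A) where
  carrier := {P | IsDiffOp A n P.1}
  add_mem' := IsDiffOp.add
  zero_mem' := IsDiffOp.zero n
  smul_mem' c _ hP := IsDiffOp.smul hP c

/-- Evaluation on finitely many functions has a linear left inverse on operators of bounded
order. -/
lemma exists_diffOp_leftInverse [Algebra.FiniteType ℂ A] (n : ℕ) :
    ∃ (B : Finset A) (π : (B → A) →ₗ[ℂ] DiffOp A),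
      ∀ P : DiffOp A, IsDiffOp A n P.1 → π (fun b => P.1 b) = P := by
  obtain ⟨B, hB⟩ := exists_finset_isDiffOp_eq_zero (A := A) n
  let r : diffOpFiltration A n →ₗ[ℂ] (B → A) :=
    LinearMap.pi fun b => (LinearMap.applyₗ (R := ℂ) b.1) ∘ₗ
      (DiffOp A).val.toLinearMap ∘ₗ (diffOpFiltration A n).subtype
  have hr : LinearMap.ker r = ⊥ := by
    rw [LinearMap.ker_eq_bot']
    intro P hP
    exact Subtype.ext <| Subtype.ext <| hB _ P.2 fun b hb => congrFun hP ⟨b, hb⟩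
  obtain ⟨q, hq⟩ := LinearMap.exists_leftInverse_of_injective r hr
  exact ⟨B, (diffOpFiltration A n).subtype ∘ₗ q, fun P hP =>
    congrArg Subtype.val (LinearMap.congr_fun hq ⟨P, hP⟩)⟩

end DiffOpFinite

/-! ### Rationality of the action of `G` on `𝒟(X)` -/

namespace AffineAction

variable {H A : Type u} [CommRing H] [HopfAlgebra ℂ H] [CommRing A] [Algebra ℂ A]
  (σ : AffineAction H A)

/-- The regular function `g ↦ g • a` on `G`. -/
noncomputable def orbitFun (a : A) : H ⊗[ℂ] A :=
  (HopfAlgebra.antipode ℂ).rTensor A (σ.coact a)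

lemma evalAt_orbitFun (g : Pt H) (a : A) : evalAt g A (σ.orbitFun a) = σ.translate g a := by
  rw [orbitFun, evalAt, contract_rTensor, translate, pull_apply]
  rfl

lemma counit_orbitFun (a : A) :
    contract (Coalgebra.counit (R := ℂ)) A (σ.orbitFun a) = a := by
  rw [orbitFun, contract_rTensor]
  simpa using σ.counit_coact a

/-- The inverse in `translate` enters through the antipode, whose derivative supplies the sign in
`comoment`. -/
lemma contract_orbitFun {x : H →ₗ[ℂ] ℂ} (hx : IsTangent H x) (a : A) :
    contract x A (σ.orbitFun a) = (σ.comoment x hx).1 a := by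
  rw [orbitFun, contract_rTensor, hx.comp_antipode]
  simp [comoment, contract]

lemma evalAt_mul (g : Pt H) (s t : H ⊗[ℂ] A) :
    evalAt g A (s * t) = evalAt g A s * evalAt g A t := by
  induction s with
  | zero => simp
  | add s s' hs hs' => simp only [add_mul, map_add, hs, hs']
  | tmul h a =>
    induction t with
    | zero => simp
    | add t t' ht ht' => simp only [mul_add, map_add, ht, ht']
    | tmul k b => simp [mul_smul, smul_comm (g.ofConv k)]

/-- For a regular function `c` on `G`, the function `g ↦ g • P(c(g))` is regular. -/
lemma exists_evalAt_eq_translate (P : Module.End ℂ A) (c : H ⊗[ℂ] A) :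
    ∃ s : H ⊗[ℂ] A, (∀ g : Pt H, evalAt g A s = σ.translate g (P (evalAt g A c))) ∧
      ∀ (x : H →ₗ[ℂ] ℂ) (hx : IsTangent H x), contract x A s =
        (σ.comoment x hx).1 (P (contract (Coalgebra.counit (R := ℂ)) A c)) +
          P (contract x A c) := by
  induction c with
  | zero => exact ⟨0, by simp⟩
  | add s t hs ht =>
    obtain ⟨s', hs, hs'⟩ := hs
    obtain ⟨t', ht, ht'⟩ := ht
    refine ⟨s' + t', fun g => by simp only [map_add, hs, ht], fun x hx => ?_⟩
    simp only [map_add, hs' x hx, ht' x hx]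
    abel
  | tmul h a =>
    -- For `c = h ⊗ a` the function is `g ↦ h(g) (g • P(a))`, a product of regular functions to
    -- which the Leibniz rule applies.
    refine ⟨(h ⊗ₜ 1) * σ.orbitFun (P a), fun g => ?_, fun x hx => ?_⟩
    · rw [evalAt_mul, evalAt_orbitFun]
      simp
    · rw [contract_mul hx, counit_orbitFun, contract_orbitFun σ hx]
      simp

/-- The action of `G` on the ring of differential operators is rational, and its differential is
`P ↦ [ν(x), P]`. -/
theorem exists_evalAt_eq_conj [Algebra.FiniteType ℂ A] (P : DiffOp A) :
    ∃ t : H ⊗[ℂ] DiffOp A, (∀ g : Pt H, σ.conj g P = evalAt g (DiffOp A) t) ∧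
      ∀ (x : H →ₗ[ℂ] ℂ) (hx : IsTangent H x),
        contract x (DiffOp A) t = σ.comoment x hx * P - P * σ.comoment x hx := by
  classical
  obtain ⟨n, hn⟩ := P.2
  -- The bound `n + 2` covers both the conjugates of `P`, of order `< n`, and the commutators with
  -- `ν(x)`, which has order `< 2`.
  obtain ⟨B, π, hπ⟩ := exists_diffOp_leftInverse (A := A) (n + 2)
  -- As a function on `G`, `σ.coact b` is `g ↦ g⁻¹ • b`, so `s b` is `g ↦ (g • P)(b)`; the map `π`
  -- then reassembles these values into operators.
  choose s hs hs' using fun b : B => σ.exists_evalAt_eq_translate P.1 (σ.coact b.1)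
  let t : H ⊗[ℂ] (B → A) := ∑ b, (LinearMap.single ℂ (fun _ : B => A) b).lTensor H (s b)
  have ht : ∀ φ : H →ₗ[ℂ] ℂ, contract φ (B → A) t = fun b => contract φ A (s b) := fun φ => by
    simp only [t, map_sum, contract_lTensor]
    ext b
    simp [Pi.single_apply]
  refine ⟨π.lTensor H t, fun g => ?_, fun x hx => ?_⟩
  · rw [evalAt, contract_lTensor, ht, ← hπ (σ.conj g P)
      ((hn.conj _ _ (σ.translate_translate_inv g)).mono (by omega))]
    congr 1
    ext b
    rw [hs b g, ← pull_apply]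
    simp [conj, translate]
  · rw [contract_lTensor, ht, ← hπ (σ.comoment x hx * P - P * σ.comoment x hx)]
    · congr 1
      ext b
      rw [hs' b x hx, σ.counit_coact]
      simp [comoment, sub_eq_add_neg]
    · have h₂ : IsDiffOp A 2 (σ.comoment x hx).1 := IsDiffOp.of_derivation fun a b => by
        simp only [comoment, LinearMap.neg_apply, LinearMap.comp_apply, AlgHom.toLinearMap_apply,
          map_mul, contract_mul hx, σ.counit_coact]
        ring
      have h := ((h₂.mul hn).mono (by omega)).add (((hn.mul h₂).smul (-1)))
      convert h using 1
      refine (sub_eq_add_neg _ _).trans (congrArg _ ?_)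
      exact (neg_one_smul ℂ (_ : Module.End ℂ A)).symm

end AffineAction

/-! ### Direct sums of equivariant modules -/

namespace QCoh

variable {H A : Type u} [CommRing H] [HopfAlgebra ℂ H] [CommRing A] [Algebra ℂ A]
  {σ : AffineAction H A}

lemma surjective_of_epi {M N : QCoh σ} (f : M ⟶ N) [Epi f] : Function.Surjective f.lin := by
  have h : f ≫ N.quotπ _ (range_stable f) = 0 := by
    ext m
    exact (quotπ_eq_zero_iff _ _ _).2 ⟨m, rfl⟩
  have h' : N.quotπ _ (range_stable f) = 0 := by rw [← cancel_epi f, h, comp_zero]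
  intro n
  exact (quotπ_eq_zero_iff _ (range_stable f) n).1 (by rw [h', zero_lin])

section DirectSum

variable {J : Type u} [DecidableEq J] (X : J → QCoh σ)

/-- The direct sum of the underlying representations. -/
noncomputable def directSumρ : Representation ℂ (Pt H) (Π₀ j, (X j).carrier) where
  toFun g := DFinsupp.mapRange.linearMap fun j => (X j).ρ g
  map_one' := LinearMap.ext fun m => DFinsupp.ext fun j => congrArg (· (m j)) (map_one (X j).ρ)
  map_mul' g h := LinearMap.ext fun m => DFinsupp.ext fun j =>
    congrArg (· (m j)) (map_mul (X j).ρ g h)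

lemma directSumρ_single (g : Pt H) (j : J) (m : (X j).carrier) :
    directSumρ X g (DFinsupp.single j m) = DFinsupp.single j ((X j).ρ g m) :=
  DFinsupp.mapRange_single (f := fun j => (X j).ρ g) (hf := fun j => map_zero ((X j).ρ g))

/-- The direct sum of a family of equivariant modules. -/
noncomputable def directSum : QCoh σ where
  carrier := Π₀ j, (X j).carrier
  ρ := directSumρ X
  equivariant g P m := by
    ext j
    exact (X j).equivariant g P (m j)
  rational_differential m := by
    induction m using DFinsupp.induction with
    | h0 => exact ⟨0, by simp⟩
    | ha j b f _ _ ih =>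
      obtain ⟨s, hs, hs'⟩ := (X j).rational_differential b
      obtain ⟨t, ht, ht'⟩ := ih
      refine ⟨(DFinsupp.lsingle (R := ℂ) (M := fun j => (X j).carrier) j).lTensor H s + t,
        fun g => ?_, fun x hx => ?_⟩
      · rw [map_add, map_add, evalAt, contract_lTensor, ← hs g, ← ht g, directSumρ_single]
        rfl
      · rw [map_add, contract_lTensor, hs' x hx, ht' x hx, smul_add]
        congr 1
        exact (DFinsupp.lsingle (R := DiffOp A) (M := fun j => (X j).carrier) j).map_smul _ b

/-- The inclusion of a summand. -/
noncomputable def directSumι (j : J) : X j ⟶ directSum X :=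
  ⟨DFinsupp.lsingle (M := fun j => (X j).carrier) j, fun g m => (directSumρ_single X g j m).symm⟩

/-- The projection to a summand. -/
noncomputable def directSumπ (j : J) : directSum X ⟶ X j :=
  ⟨DFinsupp.lapply (M := fun j => (X j).carrier) j, fun _ _ => rfl⟩

lemma lsum_directSumρ {N : QCoh σ} (f : ∀ j, X j ⟶ N) (g : Pt H) (m : Π₀ j, (X j).carrier) :
    DFinsupp.lsum ℕ (fun j => (f j).lin) (directSumρ X g m) =
      N.ρ g (DFinsupp.lsum ℕ (fun j => (f j).lin) m) := by
  induction m using DFinsupp.induction with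
  | h0 => simp
  | ha j b m _ _ ih =>
    simp only [map_add, ih, directSumρ_single]
    simp [(f j).comm]

/-- The universal property of the direct sum. -/
noncomputable def directSumDesc {N : QCoh σ} (f : ∀ j, X j ⟶ N) : directSum X ⟶ N :=
  ⟨DFinsupp.lsum ℕ fun j => (f j).lin, lsum_directSumρ X f⟩

lemma directSumι_desc {N : QCoh σ} (f : ∀ j, X j ⟶ N) (j : J) :
    directSumι X j ≫ directSumDesc X f = f j := by
  ext m
  exact DFinsupp.lsum_single ℕ (fun j => (f j).lin) j m

lemma directSumι_π_self (j : J) : directSumι X j ≫ directSumπ X j = 𝟙 _ := by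
  ext m
  exact DFinsupp.single_eq_same (β := fun j => (X j).carrier)

lemma directSumι_π_of_ne {i j : J} (h : i ≠ j) : directSumι X i ≫ directSumπ X j = 0 := by
  ext m
  exact DFinsupp.single_eq_of_ne (β := fun j => (X j).carrier) h.symm

lemma directSum_hom_ext {N : QCoh σ} {f g : directSum X ⟶ N}
    (h : ∀ j, directSumι X j ≫ f = directSumι X j ≫ g) : f = g := by
  have e : f.lin = g.lin := DFinsupp.lhom_ext' fun j => LinearMap.ext fun m =>
    congrArg (fun k : X j ⟶ N => k.lin m) (h j)
  exact Hom.ext e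

/-- The direct sum is a coproduct. -/
noncomputable def isColimitDirectSum : IsColimit (Cofan.mk (directSum X) (directSumι X)) :=
  Cofan.IsColimit.mk _ (fun s => directSumDesc X s.inj) (fun s j => directSumι_desc X s.inj j)
    fun s m hm => directSum_hom_ext X fun j => by
      rw [directSumι_desc]
      exact hm j

end DirectSum

instance : HasCoproducts.{u} (QCoh σ) := by
  classical
  exact hasCoproducts_of_colimit_cofans _ fun X => isColimitDirectSum X

/-- The coproduct is the module of finitely supported families, whose elements are determined by
their coordinates. -/
lemma eq_zero_of_comp_sigmaπ {J : Type u} [DecidableEq J] (X : J → QCoh σ) {Y : QCoh σ}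
    (f : Y ⟶ ∐ X) (hf : ∀ j, f ≫ Sigma.π X j = 0) : f = 0 := by
  let e := (coproductIsCoproduct X).coconePointUniqueUpToIso (isColimitDirectSum X)
  have he : ∀ i, Sigma.ι X i ≫ e.hom = directSumι X i := fun i =>
    (coproductIsCoproduct X).comp_coconePointUniqueUpToIso_hom (isColimitDirectSum X) ⟨i⟩
  have hπ : ∀ j, e.hom ≫ directSumπ X j = Sigma.π X j := fun j => by
    refine Sigma.hom_ext _ _ fun i => ?_
    rw [← Category.assoc, he]
    by_cases h : i = j
    · subst h
      rw [directSumι_π_self, Sigma.ι_π_eq_id]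
    · rw [directSumι_π_of_ne X h, Sigma.ι_π_of_ne X h]
  rw [← cancel_mono e.hom, zero_comp]
  ext m
  refine DFinsupp.ext fun j => ?_
  have h : f ≫ e.hom ≫ directSumπ X j = 0 := by rw [hπ, hf]
  exact congrArg (fun k : Y ⟶ X j => k.lin m) h

end QCoh

/-! ### Complete reducibility of rational representations -/

section RationalRepresentations

open scoped MonoidAlgebra

variable {H : Type u} [CommRing H] [HopfAlgebra ℂ H] {V : Type u} [AddCommGroup V] [Module ℂ V]
  {ρ : Representation ℂ (Pt H) V}

/-- A merely linear projection onto `W` suffices: it fixes the values of the orbit map, which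
already lie in `W`. -/
lemma IsRational.toRepresentation (hρ : IsRational ρ) (W : Subrepresentation ρ) :
    IsRational W.toRepresentation := by
  intro w
  obtain ⟨t, ht⟩ := hρ w.1
  obtain ⟨p, hp⟩ := W.toSubmodule.exists_isCompl
  refine ⟨(Submodule.projectionOnto _ _ hp).lTensor H t, fun g => ?_⟩
  rw [evalAt, contract_lTensor, ← ht g]
  exact (Submodule.projectionOnto_apply_left hp (W.toRepresentation g w)).symm

lemma IsRational.conj (hρ : IsRational ρ) {W : Type*} [AddCommGroup W] [Module ℂ W]
    {τ : Representation ℂ (Pt H) W} (e : V ≃ₗ[ℂ] W) (he : ∀ g v, e (ρ g v) = τ g (e v)) :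
    IsRational τ := by
  intro w
  obtain ⟨t, ht⟩ := hρ (e.symm w)
  refine ⟨e.toLinearMap.lTensor H t, fun g => ?_⟩
  rw [evalAt, contract_lTensor, ← ht g]
  simp [he]

variable (ρ) in
/-- The subrepresentation generated by a vector. -/
def orbitSpan (v : V) : Subrepresentation ρ where
  toSubmodule := Submodule.span ℂ (Set.range fun g => ρ g v)
  apply_mem_toSubmodule g w hw := by
    induction hw using Submodule.span_induction with
    | mem w hw =>
      obtain ⟨h, rfl⟩ := hw
      exact Submodule.subset_span ⟨g * h, by simp⟩
    | zero => simp
    | add x y _ _ hx hy => rw [map_add]; exact add_mem hx hy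
    | smul c x _ hx => rw [map_smul]; exact Submodule.smul_mem _ c hx

lemma mem_orbitSpan (v : V) : v ∈ (orbitSpan ρ v).toSubmodule :=
  Submodule.subset_span ⟨1, by simp⟩

lemma orbitSpan_le {v : V} {W : Subrepresentation ρ} (hv : v ∈ W) : orbitSpan ρ v ≤ W :=
  Submodule.span_le.2 fun _ ⟨g, hg⟩ => hg ▸ W.apply_mem_toSubmodule g hv

/-- If `t = ∑ hᵢ ⊗ vᵢ` is the orbit map of `v`, the orbit stays in the span of the finitely many
`vᵢ`. -/
lemma IsRational.finiteDimensional_orbitSpan (hρ : IsRational ρ) (v : V) :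
    FiniteDimensional ℂ (orbitSpan ρ v).toSubmodule := by
  classical
  obtain ⟨t, ht⟩ := hρ v
  obtain ⟨S, rfl⟩ := TensorProduct.exists_finset t
  have : FiniteDimensional ℂ (Submodule.span ℂ (S.image Prod.snd : Set V)) := inferInstance
  refine Submodule.finiteDimensional_of_le (Submodule.span_le.2 ?_)
    (S₂ := Submodule.span ℂ (S.image Prod.snd : Set V))
  rintro _ ⟨g, rfl⟩
  simp only [ht g, map_sum, contract_tmul]
  exact Submodule.sum_mem _ fun p hp => Submodule.smul_mem _ _ <|
    Submodule.subset_span (Finset.mem_coe.2 (Finset.mem_image_of_mem _ hp))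

/-- The inclusion of a subrepresentation, linear over the group algebra. -/
noncomputable def subtypeAsModule (W : Subrepresentation ρ) :
    W.toRepresentation.asModule →ₗ[ℂ[Pt H]] ρ.asModule :=
  Representation.IntertwiningMap.equivLinearMapAsModule W.toRepresentation ρ
    ⟨W.toSubmodule.subtype, fun _ => rfl⟩

lemma subtypeAsModule_injective (W : Subrepresentation ρ) :
    Function.Injective (subtypeAsModule W) :=
  Subtype.val_injective

lemma range_subtypeAsModule (W : Subrepresentation ρ) :
    LinearMap.range (subtypeAsModule W) = W.asSubmodule :=
  SetLike.ext' Subtype.range_coe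

/-- Local finiteness: the representation is the sum of its orbit spans, which are finite-dimensional
and so semisimple by reductivity. -/
lemma IsRational.isSemisimpleModule (hG : IsReductive H) (hρ : IsRational ρ) :
    IsSemisimpleModule ℂ[Pt H] ρ.asModule := by
  refine isSemisimpleModule_of_isSemisimpleModule_submodule'
    (p := fun v : V => LinearMap.range (subtypeAsModule (orbitSpan ρ v))) (fun v => ?_) ?_
  · have := hρ.finiteDimensional_orbitSpan v
    have := (Representation.isSemisimpleRepresentation_iff_isSemisimpleModule_asModule _).1
      (hG _ _ (hρ.toRepresentation (orbitSpan ρ v)))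
    exact IsSemisimpleModule.range _
  · rw [eq_top_iff]
    intro v _
    refine Submodule.mem_iSup_of_mem (show V from v) ?_
    rw [range_subtypeAsModule]
    exact mem_orbitSpan (ρ := ρ) v

/-- Equivariant maps from a rational representation lift along surjections. -/
lemma IsRational.exists_lift (hG : IsReductive H) (hρ : IsRational ρ) {W : Type u}
    [AddCommGroup W] [Module ℂ W] {τ : Representation ℂ (Pt H) W}
    (p : Representation.IntertwiningMap ρ τ) (hp : Function.Surjective p) {X : Type*}
    [AddCommGroup X] [Module ℂ X] {π : Representation ℂ (Pt H) X}
    (f : Representation.IntertwiningMap π τ) :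
    ∃ g : Representation.IntertwiningMap π ρ, ∀ x, p (g x) = f x := by
  have := hρ.isSemisimpleModule hG
  obtain ⟨g, hg⟩ := IsSemisimpleModule.lifting_property
    (Representation.IntertwiningMap.equivLinearMapAsModule ρ τ p) hp
    (Representation.IntertwiningMap.equivLinearMapAsModule π τ f)
  exact ⟨(Representation.IntertwiningMap.equivLinearMapAsModule π ρ).symm g,
    fun x => LinearMap.congr_fun hg x⟩

/-- The irreducible representation given by a simple submodule. -/
noncomputable def irrepOfSimple (hρ : IsRational ρ) (S : Submodule ℂ[Pt H] ρ.asModule)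
    [hS : IsSimpleModule ℂ[Pt H] S] : Irrep H where
  V := (Subrepresentation.ofSubmodule' S).toSubmodule
  finite := by
    obtain ⟨s, hs, hs0⟩ := S.exists_mem_ne_zero_of_ne_bot
      (isSimpleModule_iff_isAtom.1 hS).1
    -- A simple submodule is spanned by the orbit of any nonzero vector, hence finite-dimensional.
    have h : (orbitSpan ρ (show V from s)).asSubmodule = S := by
      refine ((isSimpleModule_iff_isAtom.1 hS).le_iff_eq ?_).1
        (orbitSpan_le (W := Subrepresentation.ofSubmodule' S) hs)
      intro h
      have h' : s ∈ (orbitSpan ρ (show V from s)).asSubmodule := mem_orbitSpan (ρ := ρ) s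
      rw [h] at h'
      exact hs0 h'
    have := hρ.finiteDimensional_orbitSpan (show V from s)
    rw [← h]
    exact this
  ρ := (Subrepresentation.ofSubmodule' S).toRepresentation
  rational := hρ.toRepresentation _
  irreducible := by
    rw [Representation.irreducible_iff_isSimpleModule_asModule]
    have e := LinearEquiv.ofInjective _
      (subtypeAsModule_injective (Subrepresentation.ofSubmodule' S))
    rw [range_subtypeAsModule] at e
    have : IsSimpleModule ℂ[Pt H] (Subrepresentation.ofSubmodule' S).asSubmodule := hS
    exact IsSimpleModule.congr e

/-- A rational representation is spanned by the images of irreducible ones. -/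
lemma IsRational.eq_top_of_forall_irrep (hG : IsReductive H) (hρ : IsRational ρ)
    (K : AddSubgroup V)
    (hK : ∀ (I : Irrep H) (f : Representation.IntertwiningMap I.ρ ρ) (v : I.V), f v ∈ K) (v : V) :
    v ∈ K := by
  have := hρ.isSemisimpleModule hG
  have hv : (show ρ.asModule from v) ∈
      sSup {S : Submodule ℂ[Pt H] ρ.asModule | IsSimpleModule ℂ[Pt H] S} := by
    rw [IsSemisimpleModule.sSup_simples_eq_top]
    trivial
  rw [sSup_eq_iSup'] at hv
  refine Submodule.iSup_induction _ (motive := fun v : ρ.asModule => (show V from v) ∈ K) hv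
    (fun ⟨S, hS⟩ s hs => ?_) (zero_mem K) (fun x y hx hy => add_mem hx hy)
  have : IsSimpleModule ℂ[Pt H] S := hS
  exact hK (irrepOfSimple hρ S) ⟨(Subrepresentation.ofSubmodule' S).toSubmodule.subtype,
    fun _ => rfl⟩ ⟨s, hs⟩

variable (H) in
/-- Rational representations in coordinates: a small set that contains all finite-dimensional
rational representations up to isomorphism. -/
def CoordRep :=
  Σ n : ℕ, {ρ : Representation ℂ (Pt H) (ULift.{u} (Fin n) → ℂ) // IsRational ρ}

/-- A basis transports `I` to coordinates. `Irrep H` lives one universe too high to index the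
coproducts and separating families used here; `CoordRep H` does not. -/
lemma Irrep.exists_coordRep (I : Irrep H) :
    ∃ t : CoordRep H, Nonempty (Representation.Equiv t.2.1 I.ρ) := by
  let e : I.V ≃ₗ[ℂ] (ULift.{u} (Fin (Module.finrank ℂ I.V)) → ℂ) :=
    ((Module.finBasis ℂ I.V).reindex Equiv.ulift.symm).equivFun
  let τ : Representation ℂ (Pt H) (ULift.{u} (Fin (Module.finrank ℂ I.V)) → ℂ) :=
    { toFun g := e.conj (I.ρ g)
      map_one' := by ext; simp
      map_mul' _ _ := by ext; simp }
  have he : ∀ g v, e (I.ρ g v) = τ g (e v) := fun g v => by simp [τ]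
  exact ⟨⟨_, τ, I.rational.conj e he⟩, ⟨(Representation.Equiv.mk e fun g =>
    LinearMap.ext (he g) : Representation.Equiv I.ρ τ).symm⟩⟩

end RationalRepresentations

/-! ### Induced equivariant modules -/

variable {H A : Type u} [CommRing H] [HopfAlgebra ℂ H] [CommRing A] [Algebra ℂ A]

namespace AffineAction

variable (σ : AffineAction H A)

lemma translate_one (a : A) : σ.translate 1 a = a := by
  rw [translate, inv_one, pull_one]

lemma translate_mul (g h : Pt H) (a : A) :
    σ.translate (g * h) a = σ.translate g (σ.translate h a) := by
  rw [translate, mul_inv_rev, pull_mul, translate, translate]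

lemma conj_apply (g : Pt H) (P : DiffOp A) (a : A) :
    (σ.conj g P).1 a = σ.translate g (P.1 (σ.translate g⁻¹ a)) := rfl

lemma conj_mul (g : Pt H) (P Q : DiffOp A) : σ.conj g (P * Q) = σ.conj g P * σ.conj g Q := by
  refine Subtype.ext (LinearMap.ext fun a => ?_)
  have h : ∀ b, σ.translate g⁻¹ (σ.translate g b) = b := fun b => by
    rw [← translate_mul, inv_mul_cancel, translate_one]
  change _ = (σ.conj g P).1 ((σ.conj g Q).1 a)
  rw [conj_apply, conj_apply, conj_apply, h]
  rfl

/-- The representation of `G` on the ring of differential operators. -/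
noncomputable def conjRep : Representation ℂ (Pt H) (DiffOp A) where
  toFun g :=
    { toFun := σ.conj g
      map_add' P Q := Subtype.ext (LinearMap.ext fun a => map_add (σ.translate g) _ _)
      map_smul' c P := Subtype.ext (LinearMap.ext fun a => map_smul (σ.translate g) c _) }
  map_one' := LinearMap.ext fun P => Subtype.ext <| LinearMap.ext fun a =>
    (conj_apply σ 1 P a).trans (by rw [inv_one, translate_one, translate_one]; rfl)
  map_mul' g h := LinearMap.ext fun P => Subtype.ext <| LinearMap.ext fun a =>
    (conj_apply σ (g * h) P a).trans (by rw [mul_inv_rev, translate_mul, translate_mul]; rfl)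

@[simp]
lemma conjRep_apply (g : Pt H) (P : DiffOp A) : σ.conjRep g P = σ.conj g P := rfl

lemma conj_one_right (g : Pt H) : σ.conj g 1 = 1 := by
  refine Subtype.ext (LinearMap.ext fun a => ?_)
  rw [conj_apply]
  exact σ.translate_translate_inv g a

end AffineAction

/-- Tensor products of regular functions on `G`. -/
lemma exists_contract_tmul {V W : Type*} [AddCommGroup V] [Module ℂ V] [AddCommGroup W]
    [Module ℂ W] (s : H ⊗[ℂ] V) (t : H ⊗[ℂ] W) :
    ∃ r : H ⊗[ℂ] (V ⊗[ℂ] W),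
      (∀ g : Pt H, evalAt g (V ⊗[ℂ] W) r = evalAt g V s ⊗ₜ evalAt g W t) ∧
      ∀ x, IsTangent H x → contract x (V ⊗[ℂ] W) r =
        contract (Coalgebra.counit (R := ℂ)) V s ⊗ₜ contract x W t +
          contract x V s ⊗ₜ contract (Coalgebra.counit (R := ℂ)) W t := by
  induction s with
  | zero => exact ⟨0, by simp⟩
  | add s s' hs hs' =>
    obtain ⟨r, h₁, h₂⟩ := hs
    obtain ⟨r', h₁', h₂'⟩ := hs'
    refine ⟨r + r', fun g => by simp only [map_add, h₁, h₁', TensorProduct.add_tmul],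
      fun x hx => ?_⟩
    simp only [map_add, h₂ x hx, h₂' x hx, TensorProduct.add_tmul]
    abel
  | tmul a v =>
    induction t with
    | zero => exact ⟨0, by simp⟩
    | add t t' ht ht' =>
      obtain ⟨r, h₁, h₂⟩ := ht
      obtain ⟨r', h₁', h₂'⟩ := ht'
      refine ⟨r + r', fun g => by simp only [map_add, h₁, h₁', TensorProduct.tmul_add],
        fun x hx => ?_⟩
      simp only [map_add, h₂ x hx, h₂' x hx, TensorProduct.tmul_add]
      abel
    | tmul b w =>
      refine ⟨(a * b) ⊗ₜ (v ⊗ₜ w), fun g => ?_, fun x hx => ?_⟩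
      · simp only [contract_tmul, TensorProduct.tmul_smul, ← TensorProduct.smul_tmul', smul_smul]
        simp [mul_comm]
      · simp only [contract_tmul, TensorProduct.tmul_smul, ← TensorProduct.smul_tmul', smul_smul,
          hx a b, add_smul, mul_comm]

namespace QCoh

variable (σ : AffineAction H A)

/-- A quotient of an equivariant `𝒟(X)`-module, not necessarily rational and strongly equivariant
itself. -/
noncomputable def ofQuotient {E : Type u} [AddCommGroup E] [Module ℂ E] [Module (DiffOp A) E]
    [IsScalarTower ℂ (DiffOp A) E] (τ : Representation ℂ (Pt H) E)
    (hτ : ∀ (g : Pt H) (P : DiffOp A) (m : E), τ g (P • m) = σ.conj g P • τ g m)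
    (S : Submodule (DiffOp A) E) (hS : ∀ g, ∀ m ∈ S, τ g m ∈ S)
    (hr : ∀ m : E, ∃ t : H ⊗[ℂ] E, (∀ g : Pt H, τ g m = evalAt g E t) ∧
      ∀ (x : H →ₗ[ℂ] ℂ) (hx : IsTangent H x), σ.comoment x hx • m - contract x E t ∈ S) :
    QCoh σ where
  carrier := E ⧸ S
  ρ :=
    { toFun := fun g => (S.restrictScalars ℂ).mapQ
        (S.restrictScalars ℂ) (τ g) (hS g)
      map_one' := LinearMap.ext fun m => by
        obtain ⟨m, rfl⟩ := S.mkQ_surjective m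
        exact congrArg S.mkQ (congrArg (· m) (map_one τ))
      map_mul' := fun g h => LinearMap.ext fun m => by
        obtain ⟨m, rfl⟩ := S.mkQ_surjective m
        exact congrArg S.mkQ (congrArg (· m) (map_mul τ g h)) }
  equivariant g P m := by
    obtain ⟨m, rfl⟩ := S.mkQ_surjective m
    exact congrArg S.mkQ (hτ g P m)
  rational_differential m := by
    obtain ⟨m, rfl⟩ := S.mkQ_surjective m
    obtain ⟨t, ht, hx⟩ := hr m
    let π := S.mkQ.restrictScalars ℂ
    refine ⟨π.lTensor H t, fun g => ?_, fun x h => ?_⟩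
    · refine Eq.trans ?_ (contract_lTensor _ π t).symm
      rw [← ht g]
      rfl
    · refine Eq.trans (contract_lTensor _ π t) ?_
      exact ((Submodule.Quotient.eq _).2 (hx x h)).symm

variable {V : Type u} [AddCommGroup V] [Module ℂ V]
  (ρ : Representation ℂ (Pt H) V)

/-- The diagonal action of `G` on `𝒟(X) ⊗ V`. -/
noncomputable abbrev inducedρ : Representation ℂ (Pt H) (DiffOp A ⊗[ℂ] V) :=
  σ.conjRep.tprod ρ

lemma inducedρ_smul (g : Pt H) (P : DiffOp A) (m : DiffOp A ⊗[ℂ] V) :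
    inducedρ σ ρ g (P • m) = σ.conj g P • inducedρ σ ρ g m := by
  induction m with
  | zero => simp
  | add m n hm hn => simp only [smul_add, map_add, hm, hn]
  | tmul Q v => simp [TensorProduct.smul_tmul', σ.conj_mul]

/-- The translates of the relations `ν(x) ⊗ v = 1 ⊗ x • v`. -/
def inducedRel : Set (DiffOp A ⊗[ℂ] V) :=
  {r | ∃ (g : Pt H) (x : H →ₗ[ℂ] ℂ) (hx : IsTangent H x) (v : V) (t : H ⊗[ℂ] V),
    (∀ h : Pt H, ρ h v = evalAt h V t) ∧
      r = inducedρ σ ρ g (σ.comoment x hx ⊗ₜ v - 1 ⊗ₜ contract x V t)}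

/-- The submodule of relations of the induced equivariant module. -/
def inducedKer : Submodule (DiffOp A) (DiffOp A ⊗[ℂ] V) :=
  Submodule.span _ (inducedRel σ ρ)

/-- All translates of the basic relations were included as generators, so the adjoint action on `𝔤`
need not be computed. -/
lemma inducedKer_stable (g : Pt H) (m : DiffOp A ⊗[ℂ] V) (hm : m ∈ inducedKer σ ρ) :
    inducedρ σ ρ g m ∈ inducedKer σ ρ := by
  induction hm using Submodule.span_induction with
  | mem m hm =>
    obtain ⟨h, x, hx, v, t, ht, rfl⟩ := hm
    refine Submodule.subset_span ⟨g * h, x, hx, v, t, ht, ?_⟩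
    rw [map_mul]
    rfl
  | zero => simp
  | add x y _ _ hx hy => rw [map_add]; exact add_mem hx hy
  | smul P x _ hx => rw [inducedρ_smul]; exact Submodule.smul_mem _ _ hx

-- The derivative of `g ↦ (g • P) ⊗ (g • v)` is `[ν(x), P] ⊗ v + P ⊗ x v`. Subtracting it from `ν(x)
-- P ⊗ v` leaves `P (ν(x) ⊗ v - 1 ⊗ x v)`, a multiple of a relation.
variable {ρ} in
lemma exists_evalAt_induced [Algebra.FiniteType ℂ A] (hρ : IsRational ρ)
    (m : DiffOp A ⊗[ℂ] V) :
    ∃ t : H ⊗[ℂ] (DiffOp A ⊗[ℂ] V), (∀ g : Pt H, inducedρ σ ρ g m = evalAt g _ t) ∧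
      ∀ (x : H →ₗ[ℂ] ℂ) (hx : IsTangent H x),
        σ.comoment x hx • m - contract x _ t ∈ inducedKer σ ρ := by
  induction m with
  | zero => exact ⟨0, by simp⟩
  | add m n hm hn =>
    obtain ⟨s, hs, hs'⟩ := hm
    obtain ⟨t, ht, ht'⟩ := hn
    refine ⟨s + t, fun g => by simp only [map_add, hs, ht], fun x hx => ?_⟩
    rw [smul_add, map_add, add_sub_add_comm]
    exact add_mem (hs' x hx) (ht' x hx)
  | tmul P v =>
    obtain ⟨s, hs, hs'⟩ := σ.exists_evalAt_eq_conj P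
    obtain ⟨t, ht⟩ := hρ v
    obtain ⟨r, hr, hr'⟩ := exists_contract_tmul s t
    refine ⟨r, fun g => by simp [hr, hs, ht], fun x hx => ?_⟩
    have e₁ : contract (Coalgebra.counit (R := ℂ)) _ s = P := by
      refine (hs 1).symm.trans ?_
      rw [← σ.conjRep_apply, map_one, Module.End.one_apply]
    have e₂ : contract (Coalgebra.counit (R := ℂ)) _ t = v := by
      refine (ht 1).symm.trans ?_
      rw [map_one, Module.End.one_apply]
    have h : σ.comoment x hx • (P ⊗ₜ[ℂ] v) - contract x _ r =
        P • (inducedρ σ ρ 1 (σ.comoment x hx ⊗ₜ v - 1 ⊗ₜ contract x V t)) := by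
      rw [hr' x hx, hs' x hx, e₁, e₂, map_one, Module.End.one_apply, smul_sub,
        TensorProduct.smul_tmul', TensorProduct.smul_tmul', TensorProduct.smul_tmul',
        TensorProduct.sub_tmul]
      simp only [smul_eq_mul, mul_one]
      abel
    rw [h]
    exact Submodule.smul_mem _ _ (Submodule.subset_span ⟨1, x, hx, v, t, ht, rfl⟩)

variable {ρ}

/-- The equivariant module `𝒟(X) ⊗_{U(𝔤)} V` induced from a rational representation. -/
noncomputable def induced [Algebra.FiniteType ℂ A] (hρ : IsRational ρ) : QCoh σ :=
  ofQuotient σ (inducedρ σ ρ) (inducedρ_smul σ ρ) (inducedKer σ ρ) (inducedKer_stable σ ρ)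
    (exists_evalAt_induced σ hρ)

variable [Algebra.FiniteType ℂ A] (hρ : IsRational ρ)

/-- The projection `𝒟(X) ⊗ V → 𝒟(X) ⊗_{U(𝔤)} V`. -/
noncomputable def inducedMk : DiffOp A ⊗[ℂ] V →ₗ[DiffOp A] (induced σ hρ).carrier :=
  (inducedKer σ ρ).mkQ

lemma inducedMk_surjective : Function.Surjective (inducedMk σ hρ) :=
  (inducedKer σ ρ).mkQ_surjective

/-- The canonical map `V → 𝒟(X) ⊗_{U(𝔤)} V`. -/
noncomputable def inducedι : Representation.IntertwiningMap ρ (induced σ hρ).ρ where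
  toLinearMap := (inducedMk σ hρ).restrictScalars ℂ ∘ₗ TensorProduct.mk ℂ (DiffOp A) V 1
  isIntertwining' g := LinearMap.ext fun v => by
    refine congrArg (inducedMk σ hρ) ?_
    change _ = inducedρ σ ρ g (1 ⊗ₜ v)
    simp [σ.conj_one_right]

lemma inducedMk_tmul (P : DiffOp A) (v : V) :
    inducedMk σ hρ (P ⊗ₜ v) = P • inducedι σ hρ v := by
  have e : P ⊗ₜ[ℂ] v = P • ((1 : DiffOp A) ⊗ₜ[ℂ] v) := by
    rw [TensorProduct.smul_tmul', smul_eq_mul, mul_one]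
  rw [e, map_smul]
  rfl

variable {σ}

/-- The `𝒟(X)`-linear extension of a map `V → M` to `𝒟(X) ⊗ V`. -/
noncomputable def extend {M : QCoh σ} (f : V →ₗ[ℂ] M.carrier) :
    DiffOp A ⊗[ℂ] V →ₗ[DiffOp A] M.carrier :=
  TensorProduct.AlgebraTensorModule.lift (LinearMap.toSpanSingleton (DiffOp A) _ f)

omit [Algebra.FiniteType ℂ A] in
@[simp]
lemma extend_tmul {M : QCoh σ} (f : V →ₗ[ℂ] M.carrier) (P : DiffOp A) (v : V) :
    extend f (P ⊗ₜ v) = P • f v := rfl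

omit [Algebra.FiniteType ℂ A] in
lemma extend_inducedρ {M : QCoh σ} (f : Representation.IntertwiningMap ρ M.ρ) (g : Pt H)
    (m : DiffOp A ⊗[ℂ] V) :
    extend f.toLinearMap (inducedρ σ ρ g m) = M.ρ g (extend f.toLinearMap m) := by
  induction m with
  | zero => simp
  | add m n hm hn => simp only [map_add, hm, hn]
  | tmul P v => simp [M.equivariant, f.isIntertwining]

-- Strong equivariance of `M` concerns some orbit function of `f v`, while the relation uses the
-- image of one chosen for `v`. They have equal values at all points, so they coincide because `H`
-- is reduced and of finite type.
omit [Algebra.FiniteType ℂ A] in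
lemma extend_eq_zero [Algebra.FiniteType ℂ H] [IsReduced H] {M : QCoh σ}
    (f : Representation.IntertwiningMap ρ M.ρ) (m : DiffOp A ⊗[ℂ] V)
    (hm : m ∈ inducedKer σ ρ) : extend f.toLinearMap m = 0 := by
  induction hm using Submodule.span_induction with
  | mem m hm =>
    obtain ⟨g, x, hx, v, t, ht, rfl⟩ := hm
    obtain ⟨s, hs, hs'⟩ := M.rational_differential (f v)
    have e : s = f.toLinearMap.lTensor H t := evalAt_injective fun h => by
      rw [← hs h, evalAt, contract_lTensor, ← ht h]
      exact (f.isIntertwining _ _ h v).symm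
    have e' := hs' x hx
    rw [e, contract_lTensor] at e'
    rw [extend_inducedρ, map_sub, extend_tmul, extend_tmul, one_smul, e']
    simp
  | zero => simp
  | add x y _ _ hx hy => rw [map_add, hx, hy, add_zero]
  | smul P x _ hx => rw [map_smul, hx, smul_zero]

variable [Algebra.FiniteType ℂ H] [IsReduced H]

/-- The morphism from the induced module given by an equivariant map. -/
noncomputable def inducedDesc {M : QCoh σ} (f : Representation.IntertwiningMap ρ M.ρ) :
    induced σ hρ ⟶ M :=
  ⟨(inducedKer σ ρ).liftQ (extend f.toLinearMap) (extend_eq_zero f), fun g m => by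
    obtain ⟨m, rfl⟩ := (inducedKer σ ρ).mkQ_surjective m
    exact extend_inducedρ f g m⟩

lemma inducedDesc_ι {M : QCoh σ} (f : Representation.IntertwiningMap ρ M.ρ) (v : V) :
    (inducedDesc hρ f).lin (inducedι σ hρ v) = f v :=
  one_smul _ _

omit [Algebra.FiniteType ℂ H] [IsReduced H] in
lemma induced_hom_ext {M : QCoh σ} {f g : induced σ hρ ⟶ M}
    (h : ∀ v, f.lin (inducedι σ hρ v) = g.lin (inducedι σ hρ v)) : f = g := by
  ext m
  obtain ⟨m, rfl⟩ := inducedMk_surjective σ hρ m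
  induction m with
  | zero => simp only [map_zero]
  | add m n hm hn => simp only [map_add, hm, hn]
  | tmul P v => simp only [inducedMk_tmul, map_smul, h]

omit [Algebra.FiniteType ℂ H] [IsReduced H] [Algebra.FiniteType ℂ A] in
lemma isRational (M : QCoh σ) : IsRational M.ρ := fun m =>
  let ⟨t, ht, _⟩ := M.rational_differential m
  ⟨t, ht⟩

/-- The equivariant map underlying a morphism. -/
noncomputable def Hom.toIntertwiningMap {M N : QCoh σ} (f : M ⟶ N) :
    Representation.IntertwiningMap M.ρ N.ρ where
  toLinearMap := f.lin.restrictScalars ℂ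
  isIntertwining' g := LinearMap.ext (f.comm g)

/-- A morphism out of the induced module is an equivariant map out of `V`, and such maps lift along
the surjection `p` because the rational representation `M` is semisimple. -/
lemma projective_induced (hG : IsReductive H) : Projective (induced σ hρ) where
  factors {M N} f p _ := by
    obtain ⟨g, hg⟩ := M.isRational.exists_lift hG (Hom.toIntertwiningMap p)
      (surjective_of_epi p) ((Hom.toIntertwiningMap f).comp (inducedι σ hρ))
    refine ⟨inducedDesc hρ g, induced_hom_ext hρ fun v => ?_⟩
    rw [comp_lin, inducedDesc_ι]
    exact hg v

omit [Algebra.FiniteType ℂ A] [Algebra.FiniteType ℂ H] [IsReduced H] in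
lemma isotypic_eq_bot_iff (M : QCoh σ) (l : DominantWeight H) :
    M.isotypic l = ⊥ ↔ ∀ I : Irrep H, (⟦I⟧ : Quotient (irrepSetoid H)) = l →
      ∀ (f : Representation.IntertwiningMap I.ρ M.ρ) (v : I.V), f v = 0 := by
  simp only [isotypic, iSup_eq_bot, LinearMap.range_eq_bot]
  exact ⟨fun h I hI f v => LinearMap.congr_fun (h I hI f) v,
    fun h I hI f => LinearMap.ext fun v => h I hI f v⟩

end QCoh

/-! ### Induced modules as separators and as tests for isotypic components -/

namespace QCoh

variable {H A : Type u} [CommRing H] [HopfAlgebra ℂ H] [CommRing A] [Algebra ℂ A]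
  (σ : AffineAction H A) [Algebra.FiniteType ℂ A]

/-- The induced modules of the finite-dimensional rational representations. -/
noncomputable def inducedFamily (t : CoordRep H) : QCoh σ := induced σ t.2.2

variable {σ} [Algebra.FiniteType ℂ H] [IsReduced H]

/-- The universal property of induction, transported along `e`. General `f` and `g` serve for
separation; the pair `𝟙 M`, `0` serves for the orthogonal. -/
lemma comp_inducedFamily_eq_iff {M N : QCoh σ} (f g : M ⟶ N) {I : Irrep H} {t : CoordRep H}
    (e : Representation.Equiv t.2.1 I.ρ) :
    (∀ h : inducedFamily σ t ⟶ M, h ≫ f = h ≫ g) ↔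
      ∀ (φ : Representation.IntertwiningMap I.ρ M.ρ) (v : I.V), f.lin (φ v) = g.lin (φ v) := by
  refine ⟨fun h φ v => ?_, fun h k => induced_hom_ext t.2.2 fun v => ?_⟩
  · let k := inducedDesc (σ := σ) t.2.2 (φ.comp e.toIntertwiningMap)
    have h' : f.lin (k.lin (inducedι σ t.2.2 (e.symm v))) =
        g.lin (k.lin (inducedι σ t.2.2 (e.symm v))) :=
      congrArg (fun k : induced σ t.2.2 ⟶ N => k.lin (inducedι σ t.2.2 (e.symm v))) (h k)
    rw [inducedDesc_ι] at h'
    have e' : φ.comp e.toIntertwiningMap (e.symm v) = φ v :=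
      congrArg φ (e.apply_symm_apply v)
    rwa [e'] at h'
  · have h' := h (((Hom.toIntertwiningMap k).comp (inducedι σ t.2.2)).comp
      e.symm.toIntertwiningMap) (e v)
    have e' : (((Hom.toIntertwiningMap k).comp (inducedι σ t.2.2)).comp
      e.symm.toIntertwiningMap) (e v) = k.lin (inducedι σ t.2.2 v) :=
      congrArg (fun w => k.lin (inducedι σ t.2.2 w)) (e.symm_apply_apply v)
    rwa [e'] at h'

/-- Morphisms that agree on all induced modules agree on the images of all irreducibles, and these
span `M` by complete reducibility. -/
lemma isSeparating_inducedFamily (hG : IsReductive H) :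
    (ObjectProperty.ofObj (inducedFamily σ)).IsSeparating := by
  intro M N f g h
  ext m
  rw [← sub_eq_zero]
  refine M.isRational.eq_top_of_forall_irrep hG (f.lin - g.lin).toAddMonoidHom.ker
    (fun I φ v => ?_) m
  obtain ⟨t, ⟨e⟩⟩ := I.exists_coordRep
  exact sub_eq_zero.2 ((comp_inducedFamily_eq_iff f g e).1
    (fun k => h _ (ObjectProperty.ofObj_apply _ t) k) φ v)

variable (σ) in
/-- The induced modules of the irreducible representations with class in `U`. -/
noncomputable def inducedSubfamily (U : Set (DominantWeight H)) :
    {t : CoordRep H // ∃ I : Irrep H, (⟦I⟧ : Quotient (irrepSetoid H)) ∈ U ∧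
      Nonempty (Representation.Equiv t.2.1 I.ρ)} → QCoh σ :=
  fun t => inducedFamily σ t.1

/-- An isotypic component vanishes iff no irreducible of that class maps nontrivially to `M`, that
is, iff the corresponding induced modules have no nonzero morphism to `M`. -/
lemma vanishing_eq_rightOrthogonal (U : Set (DominantWeight H)) :
    vanishing σ U = rightOrthogonal (inducedSubfamily σ U) := by
  have key (M : QCoh σ) {I : Irrep H} {t : CoordRep H}
      (e : Representation.Equiv t.2.1 I.ρ) : (∀ h : inducedFamily σ t ⟶ M, h = 0) ↔
        ∀ (φ : Representation.IntertwiningMap I.ρ M.ρ) (v : I.V), φ v = 0 := by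
    simpa using comp_inducedFamily_eq_iff (𝟙 M) 0 e
  ext M
  refine ⟨fun h ⟨t, I, hI, ⟨e⟩⟩ => ?_, fun h l hl => ?_⟩
  · exact (key M e).2 ((isotypic_eq_bot_iff M _).1 (h _ hI) I rfl)
  · rw [isotypic_eq_bot_iff]
    rintro I rfl
    obtain ⟨t, ⟨e⟩⟩ := I.exists_coordRep
    exact (key M e).1 (h ⟨t, I, hl, ⟨e⟩⟩)

end QCoh

end EqDMod

theorem mainTheorem8 {H A : Type u}
    [CommRing H] [HopfAlgebra ℂ H] [Algebra.FiniteType ℂ H] [IsReduced H]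
    [ConnectedSpace (PrimeSpectrum H)] (hG : EqDMod.IsReductive H)
    [CommRing A] [Algebra ℂ A] [Algebra.Smooth ℂ A]
    (σ : EqDMod.AffineAction H A) (U : Set (EqDMod.DominantWeight H)) :
    ∃ _ : (EqDMod.QCoh.vanishing σ U).IsSerreClass,
      Nonempty (EqDMod.Recollement (EqDMod.QCoh.vanishing σ U).ι
        (EqDMod.quotientFunctor (EqDMod.QCoh.vanishing σ U))) := by
  have : ∀ t, Projective (EqDMod.QCoh.inducedSubfamily σ U t) := fun t =>
    EqDMod.QCoh.projective_induced t.1.2.2 hG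
  rw [EqDMod.QCoh.vanishing_eq_rightOrthogonal]
  exact ⟨EqDMod.isSerreClass_rightOrthogonal _, EqDMod.nonempty_recollement_rightOrthogonal
    EqDMod.QCoh.eq_zero_of_comp_sigmaπ (EqDMod.QCoh.isSeparating_inducedFamily hG)⟩
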